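/- Consider the monocular visual-inertial odometry (VIO) system with state $\gamma\in\mathbb R^2$ (landmark direction in the camera frame), $\rho$ (inverse depth), $\mathbf v,\mathbf g\in\mathbb R^3$ (velocity and gravity in the body frame), constant parameters $\theta=(\mathbf b_g,\mathbf b_a,M_g,T_s,M_a,\mathbf p_{CB},\mathbf q_{CB},f_x,f_y,c_x,c_y,k_1,k_2,p_1,p_2)$ with $M_a$ lower triangular, and input $\mathbf u=(\mathbf a_m,\boldsymbol\omega_m)$, a smooth function of the IMU time. With $\mathbf a_t=M_a(\mathbf a_m-\mathbf b_a)$, $\boldsymbol\omega_t=M_g(\boldsymbol\omega_m-\mathbf b_g)-M_gT_s(\mathbf a_m-\mathbf b_a)$, $\bar\gamma=(\gamma,1)$ and $R$ the rotation of $\mathbf q_{CB}$, the dynamics is $$\begin{bmatrix}\dot\gamma\\ \dot\rho\end{bmatrix}=\begin{bmatrix}I_2&-\gamma\\0&-\rho\end{bmatrix}\big[(R\boldsymbol\omega_t)\times(\rho\,\mathbf p_{CB}-\bar\gamma)-\rho R\mathbf v\big],\quad \dot{\mathbf v}=\mathbf v\times\boldsymbol\omega_t+\mathbf a_t+\mathbf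 g,\quad \dot{\mathbf g}=\mathbf g\times\boldsymbol\omega_t .$$ The observation $\mathbf h(\mathbf x)$ is the image point (column, row) of $\gamma$ under the pinhole radial-tangential camera model, either alone or together with $|\mathbf g|^2$ and $|\mathbf q_{CB}|^2$. The camera has a rolling shutter, an unknown time offset $t_d$, image height $h>0$ and an unknown frame readout time $t_r$: the record $\mathbf y$, a continuous function of the camera time $t$ with row coordinate $v(t)$, satisfies $$\mathbf y(t)=\mathbf h\big(\mathbf x(t+t_d+(v(t)/h-\kappa)\,t_r)\big),$$ where $\kappa h$ is the reference row ($\kappa=\tfrac12$: central row; $\kappa=0$: $t+t_d+v(t)\,d$ with the line delay $d=t_r/h$). The full state $\xi$ consists of $(\gamma,\rho,\mathbf v,\mathbf g)$ at the time of the first observation, $\theta$, $t_d$ and $t_r$. Given $\mathbf u$ and a record $\mathbf y$ of $\xi$ on $[t_0,t_0+T]$, the readout time is called weakly observable at $\xi$ if some neighbourhood of $\xi$ contains no full state that has a different readout time and produces the same record $\mathbf y$ on $[t_0,t_0+T]$ under the same input $\mathbf u$. (a) The readout time (equivalently, the line delay) is weakly observable in general: for every full state $\xi$ with $\rho>0$,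 $|\mathbf q_{CB}|=1$, $M_g$ and $M_a$ invertible and $f_x,f_y>0$, there is a meagre set of inputs in $C^\infty(\mathbb R,\mathbb R^6)$ such that for every input $\mathbf u$ outside it, every $T>0$ and every record $\mathbf y$ of $\xi$ under $\mathbf u$ on $[t_0,t_0+T]$, the readout time is weakly observable at $\xi$. (b) Trivially constant observations are an exception: for every full state $\xi$, every smooth input and every $T>0$, if a record $\mathbf y$ of $\xi$ on $[t_0,t_0+T]$ is constant, then the readout time is not weakly observable at $\xi$ from it. -/

import Mathlib

open Set Filter Topology Matrix
open scoped ContDiff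

noncomputable section

namespace RSVIO

/-! ### The state of the visual-inertial system -/

/-- Vectors of `ℝ³`. -/
abbrev V3 := Fin 3 → ℝ

/-- The time-varying part of the state: direction `γ` and inverse depth `ρ` of the landmark in the
camera frame, velocity `v` and gravity vector `g` in the body frame. -/
abbrev NavState := (Fin 2 → ℝ) × ℝ × V3 × V3

namespace NavState
/-- Direction `γ = (p_x / p_z, p_y / p_z)` of the landmark in the camera frame. -/
abbrev γ (x : NavState) : Fin 2 → ℝ := x.1
/-- Inverse depth `ρ = 1 / p_z` of the landmark in the camera frame. -/
abbrev ρ (x : NavState) : ℝ := x.2.1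
/-- Velocity in the body frame. -/
abbrev v (x : NavState) : V3 := x.2.2.1
/-- Gravity in the body frame. -/
abbrev g (x : NavState) : V3 := x.2.2.2
end NavState

/-- The constant part of the state: biases `b_g`, `b_a`, the matrices `M_g`, `T_s`, the six entries
of the lower triangular `M_a`, the camera extrinsics `p_CB`, `q_CB`, and the eight parameters
`f_x, f_y, c_x, c_y, k_1, k_2, p_1, p_2` of the pinhole radial-tangential camera. -/
abbrev Calib :=
  V3 × V3 × Matrix (Fin 3) (Fin 3) ℝ × Matrix (Fin 3) (Fin 3) ℝ × (Fin 6 → ℝ) ×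
    V3 × (Fin 4 → ℝ) × (Fin 8 → ℝ)

namespace Calib
/-- Gyroscope bias. -/
abbrev bg (θ : Calib) : V3 := θ.1
/-- Accelerometer bias. -/
abbrev ba (θ : Calib) : V3 := θ.2.1
/-- Gyroscope scale, misalignment and orientation matrix. -/
abbrev Mg (θ : Calib) : Matrix (Fin 3) (Fin 3) ℝ := θ.2.2.1
/-- Gyroscope `g`-sensitivity matrix. -/
abbrev Ts (θ : Calib) : Matrix (Fin 3) (Fin 3) ℝ := θ.2.2.2.1
/-- The six free entries of the accelerometer matrix. -/
abbrev maVec (θ : Calib) : Fin 6 → ℝ := θ.2.2.2.2.1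
/-- Accelerometer scale and misalignment matrix (lower triangular). -/
def Ma (θ : Calib) : Matrix (Fin 3) (Fin 3) ℝ :=
  !![θ.maVec 0, 0, 0;
     θ.maVec 1, θ.maVec 2, 0;
     θ.maVec 3, θ.maVec 4, θ.maVec 5]
/-- Position of the body origin in the camera frame. -/
abbrev pCB (θ : Calib) : V3 := θ.2.2.2.2.2.1
/-- The quaternion `q_CB = (q_w, q_x, q_y, q_z)`. -/
abbrev qCB (θ : Calib) : Fin 4 → ℝ := θ.2.2.2.2.2.2.1
/-- The camera intrinsics `(f_x, f_y, c_x, c_y, k_1, k_2, p_1, p_2)`. -/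
abbrev intr (θ : Calib) : Fin 8 → ℝ := θ.2.2.2.2.2.2.2

/-- The matrix of the quaternion `q_CB`; it is the rotation `R_CB` when `q_CB` is a unit
quaternion. -/
def RCB (θ : Calib) : Matrix (Fin 3) (Fin 3) ℝ :=
  let w := θ.qCB 0
  let x := θ.qCB 1
  let y := θ.qCB 2
  let z := θ.qCB 3
  !![w ^ 2 + x ^ 2 - y ^ 2 - z ^ 2, 2 * (x * y - w * z), 2 * (x * z + w * y);
     2 * (x * y + w * z), w ^ 2 - x ^ 2 + y ^ 2 - z ^ 2, 2 * (y * z - w * x);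
     2 * (x * z - w * y), 2 * (y * z + w * x), w ^ 2 - x ^ 2 - y ^ 2 + z ^ 2]
end Calib

/-- The full unknown state: the navigation state at the first observation, the constant parameters,
the camera time offset `t_d`, and the frame readout time `t_r`. -/
abbrev FullState := NavState × Calib × ℝ × ℝ

namespace FullState
/-- Navigation state at the first observation. -/
abbrev nav (ξ : FullState) : NavState := ξ.1
/-- IMU parameters, camera extrinsics and intrinsics. -/
abbrev cal (ξ : FullState) : Calib := ξ.2.1
/-- Time offset of the camera clock relative to the IMU clock. -/
abbrev td (ξ : FullState) : ℝ := ξ.2.2.1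
/-- Frame readout time. -/
abbrev tr (ξ : FullState) : ℝ := ξ.2.2.2
end FullState

/-! ### Control inputs: smooth IMU readings -/

/-- Values of the control input: the accelerometer reading `a_m` and the gyroscope reading `ω_m`. -/
abbrev Input := V3 × V3

/-- Smooth control inputs, as functions of the IMU time. -/
structure SmoothInput where
  /-- The input as a function of the IMU time. -/
  val : ℝ → Input
  smooth : ContDiff ℝ ∞ val

/-- The `k`-th derivative of a smooth input, as a continuous map. -/
def SmoothInput.deriv (u : SmoothInput) (k : ℕ) : C(ℝ, Input) :=
  ⟨iteratedDeriv k u.val, u.smooth.continuous_iteratedDeriv k (by exact_mod_cast le_top)⟩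

/-- The `C^∞` topology: locally uniform convergence of all derivatives. -/
instance SmoothInput.instTopology : TopologicalSpace SmoothInput :=
  TopologicalSpace.induced SmoothInput.deriv inferInstance

/-! ### The dynamics -/

/-- Calibrated acceleration `a_t = M_a (a_m - b_a)`. -/
def accel (θ : Calib) (u : Input) : V3 := θ.Ma *ᵥ (u.1 - θ.ba)

/-- Calibrated angular rate `ω_t = M_g (ω_m - b_g) - M_g T_s (a_m - b_a)`. -/
def angRate (θ : Calib) (u : Input) : V3 :=
  θ.Mg *ᵥ (u.2 - θ.bg) - θ.Mg *ᵥ (θ.Ts *ᵥ (u.1 - θ.ba))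

/-- The vector `ρ ṗ`, with `p` the landmark in the camera frame:
`(R_CB ω_t) × (ρ p_CB - (γ, 1)) - R_CB ρ v`. -/
def landmarkRate (θ : Calib) (x : NavState) (u : Input) : V3 :=
  (θ.RCB *ᵥ angRate θ u) ⨯₃ (x.ρ • θ.pCB - ![x.γ 0, x.γ 1, 1]) - x.ρ • (θ.RCB *ᵥ x.v)

/-- The right-hand side of the system; the constant parameters have derivative zero. -/
def dyn (θ : Calib) (x : NavState) (u : Input) : NavState :=
  (![landmarkRate θ x u 0 - x.γ 0 * landmarkRate θ x u 2,
     landmarkRate θ x u 1 - x.γ 1 * landmarkRate θ x u 2],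
   - x.ρ * landmarkRate θ x u 2,
   x.v ⨯₃ angRate θ u + accel θ u + x.g,
   x.g ⨯₃ angRate θ u)

/-! ### The observations -/

/-- Column coordinate of the landmark's image (pinhole radial-tangential model). -/
def imgCol (θ : Calib) (x : NavState) : ℝ :=
  let a := x.γ 0
  let b := x.γ 1
  let r2 := a ^ 2 + b ^ 2
  θ.intr 0 * (a * (1 + θ.intr 4 * r2 + θ.intr 5 * r2 ^ 2) + 2 * θ.intr 6 * a * b +
    θ.intr 7 * (r2 + 2 * a ^ 2)) + θ.intr 2

/-- Row coordinate of the landmark's image (pinhole radial-tangential model). -/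
def imgRow (θ : Calib) (x : NavState) : ℝ :=
  let a := x.γ 0
  let b := x.γ 1
  let r2 := a ^ 2 + b ^ 2
  θ.intr 1 * (b * (1 + θ.intr 4 * r2 + θ.intr 5 * r2 ^ 2) + θ.intr 6 * (r2 + 2 * b ^ 2) +
    2 * θ.intr 7 * a * b) + θ.intr 3

/-- The image observation alone: column and row. -/
def imageObs (θ : Calib) (x : NavState) : Fin 2 → ℝ := ![imgCol θ x, imgRow θ x]

/-- All observations: column, row, squared gravity magnitude, squared quaternion norm. -/
def fullObs (θ : Calib) (x : NavState) : Fin 4 → ℝ :=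
  ![imgCol θ x, imgRow θ x, x.g ⬝ᵥ x.g, θ.qCB ⬝ᵥ θ.qCB]

/-- IMU time at which a landmark that appears in row `v` at camera time `t` is observed:
`t + t_d + (v / H - κ) t_r`, where `H` is the image height and the row `κ H` is the one that is
exposed at camera time `t`. The choice `κ = 1 / 2` refers to the central row; `κ = 0`, `H = 1` gives
`t + t_d + v d`, with the line delay `d` in the place of `t_r`. -/
def rsTime (H κ : ℝ) (ξ : FullState) (t v : ℝ) : ℝ := t + ξ.td + (v / H - κ) * ξ.tr

section Observability

variable {n : ℕ} (h : Calib → NavState → Fin (n + 2) → ℝ) (H κ t₀ T : ℝ)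

/-- `y` is, for camera times in `[t₀, t₀ + T]`, a record of the observations `h` that the full state
`ξ` produces under the input `u`: some solution of the dynamics that is in the state `ξ.nav` at the
time of the first observation satisfies the rolling-shutter observation equation
`y t = h (x (t + t_d + (v t / H - κ) t_r))`, with `v t = y t 1` the row in the record itself. -/
def IsRecord (ξ : FullState) (u : SmoothInput) (y : ℝ → Fin (n + 2) → ℝ) : Prop :=
  ContinuousOn y (Icc t₀ (t₀ + T)) ∧
  ∃ (a b : ℝ) (x : ℝ → NavState),
    (∀ s ∈ Ioo a b, HasDerivAt x (dyn ξ.cal (x s) (u.val s)) s) ∧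
    (∀ t ∈ Icc t₀ (t₀ + T), rsTime H κ ξ t (y t 1) ∈ Ioo a b) ∧
    x (rsTime H κ ξ t₀ (y t₀ 1)) = ξ.nav ∧
    ∀ t ∈ Icc t₀ (t₀ + T), y t = h ξ.cal (x (rsTime H κ ξ t (y t 1)))

/-- The readout time is weakly observable at `ξ` from the input `u` and the record `y` on
`[t₀, t₀ + T]`: in some neighbourhood of `ξ`, no full state with another readout time produces the
same record under the same input. -/
def ReadoutWeaklyObservable (ξ : FullState) (u : SmoothInput) (y : ℝ → Fin (n + 2) → ℝ) : Prop :=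
  ∃ N ∈ 𝓝 ξ, ∀ ξ' ∈ N, IsRecord h H κ t₀ T ξ' u y → ξ'.tr = ξ.tr

/-- The readout time is weakly observable at `ξ` for generic inputs: all smooth inputs outside a
meagre set determine it locally, from the observations on any time interval, however short. -/
def ReadoutGenericallyObservable (ξ : FullState) : Prop :=
  ∀ᶠ u in residual SmoothInput, ∀ T : ℝ, 0 < T → ∀ y : ℝ → Fin (n + 2) → ℝ,
    IsRecord h H κ t₀ T ξ u y → ReadoutWeaklyObservable h H κ t₀ T ξ u y

/-- The readout time is not weakly observable from a record that is constant. -/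
def ReadoutUnobservableIfConstant (ξ : FullState) : Prop :=
  ∀ (u : SmoothInput) (T : ℝ), 0 < T → ∀ y : ℝ → Fin (n + 2) → ℝ,
    IsRecord h H κ t₀ T ξ u y → (∀ t ∈ Icc t₀ (t₀ + T), y t = y t₀) →
      ¬ ReadoutWeaklyObservable h H κ t₀ T ξ u y

end Observability

/-- States of an actual sensor rig: the landmark is in front of the camera at finite depth, the
quaternion has norm one, the scale and misalignment matrices of the IMU are invertible, and the focal
lengths are positive. -/
structure FullState.Regular (ξ : FullState) : Prop where
  depth : 0 < ξ.nav.ρ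
  quat : ξ.cal.qCB ⬝ᵥ ξ.cal.qCB = 1
  gyro : ξ.cal.Mg.det ≠ 0
  acc : ξ.cal.Ma.det ≠ 0
  focal_x : 0 < ξ.cal.intr 0
  focal_y : 0 < ξ.cal.intr 1

end RSVIO

end

/-!
Weak observability is a dimension count. If another full state produces the same record, then the
columns shown by `ξ` at `N` times are those of a solution of the system, for unknown parameters, at
times shifted by `c + d * row`. With `n` unknowns in the initial value of that solution, such tuples
of image points have dimension at most `n + 2 + N`, which is less than `2 * N` for large `N`,
provided that the shifted times avoid the window of the samples, so that changing the input on the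
window does not affect the solution. Small changes of the accelerometer readings move the image
points freely: the velocity steers the direction of the landmark while its depth stays the same, and
the camera model is a local diffeomorphism at points arbitrarily close to any given one. So the
exceptional inputs have empty interior; by compactness they form countably many closed sets. For all
other inputs `c + d * row` vanishes, and since the row is not constant, `d` does, which is the
difference of the line delays. For a constant record, the time offset compensates for any change of
the readout time.
-/

noncomputable section

namespace RSVIO

namespace SmoothInput

theorem continuous_deriv (k : ℕ) : Continuous fun u : SmoothInput => u.deriv k :=
  (continuous_apply k).comp (continuous_induced_dom (f := SmoothInput.deriv))

theorem continuous_eval : Continuous fun p : SmoothInput × ℝ => p.1.val p.2 := by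
  have h : Continuous fun p : SmoothInput × ℝ => (p.1.deriv 0) p.2 :=
    ((continuous_deriv 0).comp continuous_fst).eval continuous_snd
  simpa only [SmoothInput.deriv, iteratedDeriv_zero, ContinuousMap.coe_mk] using h

instance : FirstCountableTopology SmoothInput :=
  TopologicalSpace.firstCountableTopology_induced _ _ SmoothInput.deriv

end SmoothInput

/-! ### Compactness and category -/

/-- The curves with Lipschitz constant `n` and norm at most `n`: an exhaustion of the bounded
Lipschitz curves by compact sets. -/
def boundedLipschitz (E : Type*) [NormedAddCommGroup E] (n : ℕ) : Set C(ℝ, E) :=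
  {Y | LipschitzWith n Y ∧ ∀ t, Y t ∈ Metric.closedBall 0 n}

theorem isCompact_boundedLipschitz (E : Type*) [NormedAddCommGroup E] [ProperSpace E] (n : ℕ) :
    IsCompact (boundedLipschitz E n) := by
  refine ArzelaAscoli.isCompact_of_equicontinuous _ ?_
    (LipschitzWith.uniformEquicontinuous _ n fun Y => Y.2.1).equicontinuous
  have hrange : ContinuousMap.toFun '' boundedLipschitz E n =
      {f : ℝ → E | ∀ s t, dist (f s) (f t) ≤ n * dist s t} ∩
        univ.pi fun _ => Metric.closedBall 0 n := by
    ext f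
    refine ⟨?_, fun ⟨hlip, hbdd⟩ => ?_⟩
    · rintro ⟨Y, hY, rfl⟩
      exact ⟨hY.1.dist_le_mul, fun t _ => hY.2 t⟩
    · have hlip : LipschitzWith n f := LipschitzWith.of_dist_le_mul hlip
      exact ⟨⟨f, hlip.continuous⟩, ⟨hlip, fun t => hbdd t trivial⟩, rfl⟩
  rw [hrange]
  refine (isCompact_univ_pi fun _ => isCompact_closedBall _ _).inter_left ?_
  simp only [ofPred_forall]
  exact isClosed_iInter fun s => isClosed_iInter fun t =>
    isClosed_le ((continuous_apply s).dist (continuous_apply t)) continuous_const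

theorem isClosed_exists_mem_of_isCompact {X Z : Type*} [TopologicalSpace X] [TopologicalSpace Z]
    {K : Set Z} (hK : IsCompact K) {R : Set (X × Z)} (hR : IsClosed R) :
    IsClosed {x | ∃ z ∈ K, (x, z) ∈ R} := by
  have := isCompact_iff_compactSpace.mp hK
  convert isClosedMap_fst_of_compactSpace (X := X) (Y := K) _
    (hR.preimage (continuous_id.prodMap continuous_subtype_val)) using 1
  ext x
  simp

theorem isMeagre_exists_mem_of_interior_eq_empty {X Z : Type*} [TopologicalSpace X]
    [TopologicalSpace Z] {K : ℕ → Set Z} (hK : ∀ n, IsCompact (K n)) {R : Set (X × Z)}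
    (hR : IsClosed R) (hint : interior {x | ∃ n, ∃ z ∈ K n, (x, z) ∈ R} = ∅) :
    IsMeagre {x | ∃ n, ∃ z ∈ K n, (x, z) ∈ R} := by
  rw [ofPred_exists] at hint ⊢
  refine isMeagre_iUnion fun n => IsNowhereDense.isMeagre ?_
  rw [(isClosed_exists_mem_of_isCompact (hK n) hR).isNowhereDense_iff, ← subset_empty_iff, ← hint]
  exact interior_mono (subset_iUnion (fun n => {x | ∃ z ∈ K n, (x, z) ∈ R}) n)

/-! ### Integral curves of time-dependent vector fields -/

section IntegralCurves

variable {E : Type*} [NormedAddCommGroup E] [NormedSpace ℝ E] {v : ℝ → E → E} {a b R : ℝ}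
  {Y Z : ℝ → E}

theorem hasDerivWithinAt_Ici_of_isIntegralCurveOn (h : IsIntegralCurveOn Y v (Icc a b)) {t : ℝ}
    (ht : t ∈ Ico a b) : HasDerivWithinAt Y (v t (Y t)) (Ici t) t :=
  (h t (Ico_subset_Icc_self ht)).mono_of_mem_nhdsWithin (Icc_mem_nhdsGE_of_mem ht)

theorem isIntegralCurveOn_iff_hasDerivAt {s : Set ℝ} (hs : IsOpen s) :
    IsIntegralCurveOn Y v s ↔ ∀ t ∈ s, HasDerivAt Y (v t (Y t)) t :=
  forall₂_congr fun _ ht =>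
    ⟨fun h => h.hasDerivAt (hs.mem_nhds ht), fun h => h.hasDerivWithinAt⟩

theorem exists_mapsTo_closedBall_of_isIntegralCurveOn (h : IsIntegralCurveOn Y v (Icc a b)) :
    ∃ R : ℝ, MapsTo Y (Icc a b) (Metric.closedBall 0 R) := by
  obtain ⟨R, hR⟩ :=
    (isCompact_Icc.image_of_continuousOn h.continuousOn).isBounded.subset_closedBall 0
  exact ⟨R, mapsTo_iff_image_subset.mpr hR⟩

theorem isIntegralCurveOn_Icc_iff_integral [CompleteSpace E] (hv : Continuous ↿v)
    (hY : Continuous Y) :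
    IsIntegralCurveOn Y v (Icc a b) ↔
      ∀ t ∈ Icc a b, Y t = Y a + ∫ s in a..t, v s (Y s) := by
  have hc : Continuous fun s => v s (Y s) := hv.comp (continuous_id.prodMk hY)
  refine ⟨fun h t ht => ?_, fun h t ht => ?_⟩
  · rw [intervalIntegral.integral_eq_sub_of_hasDerivAt_of_le ht.1 hY.continuousOn
      (fun s hs => (h s ⟨hs.1.le, hs.2.le.trans ht.2⟩).hasDerivAt
        (Icc_mem_nhds hs.1 (hs.2.trans_le ht.2))) (hc.intervalIntegrable _ _),
      add_sub_cancel]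
  · have hint : HasDerivAt (fun t => Y a + ∫ s in a..t, v s (Y s)) (v t (Y t)) t :=
      (intervalIntegral.integral_hasDerivAt_right (hc.intervalIntegrable _ _)
        (hc.stronglyMeasurableAtFilter _ _) hc.continuousAt).const_add _
    exact hint.hasDerivWithinAt.congr h (h t ht)

theorem exists_lipschitzOnWith_field [FiniteDimensional ℝ E] (hv : ContDiff ℝ 1 ↿v) (a b R : ℝ) :
    ∃ K : NNReal, ∀ t ∈ Icc a b, LipschitzOnWith K (v t) (Metric.closedBall 0 R) := by
  have : ProperSpace E := FiniteDimensional.proper ℝ E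
  obtain ⟨K, hK⟩ := hv.contDiffOn.exists_lipschitzOnWith one_ne_zero
    ((convex_Icc a b).prod (convex_closedBall (0 : E) R))
    (isCompact_Icc.prod (isCompact_closedBall _ _))
  refine ⟨K, fun t ht => LipschitzOnWith.of_dist_le_mul fun x hx y hy => ?_⟩
  have h := hK.dist_le_mul (t, x) ⟨ht, hx⟩ (t, y) ⟨ht, hy⟩
  rwa [Prod.dist_eq, dist_self, max_eq_right dist_nonneg] at h

theorem exists_lipschitzOnWith_of_isIntegralCurveOn [ProperSpace E] (hv : Continuous ↿v)
    (a b R : ℝ) :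
    ∃ M : NNReal, ∀ Y : ℝ → E, IsIntegralCurveOn Y v (Icc a b) →
      MapsTo Y (Icc a b) (Metric.closedBall 0 R) → LipschitzOnWith M Y (Icc a b) := by
  obtain ⟨M, hM⟩ := ((isCompact_Icc.prod (isCompact_closedBall (0 : E) R)).image
    hv).isBounded.subset_closedBall 0
  refine ⟨M.toNNReal, fun Y hY hR => ?_⟩
  refine (convex_Icc a b).lipschitzOnWith_of_nnnorm_hasDerivWithin_le hY fun t ht => ?_
  exact NNReal.le_toNNReal_of_coe_le (mem_closedBall_zero_iff.mp (hM ⟨(t, Y t), ⟨ht, hR ht⟩, rfl⟩))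

theorem dist_le_of_isIntegralCurveOn {K : NNReal}
    (hK : ∀ t ∈ Icc a b, LipschitzOnWith K (v t) (Metric.closedBall 0 R))
    (hY : IsIntegralCurveOn Y v (Icc a b)) (hYR : MapsTo Y (Icc a b) (Metric.closedBall 0 R))
    (hZ : IsIntegralCurveOn Z v (Icc a b)) (hZR : MapsTo Z (Icc a b) (Metric.closedBall 0 R))
    {t : ℝ} (ht : t ∈ Icc a b) :
    dist (Y t) (Z t) ≤ Real.exp (K * (b - a)) * dist (Y a) (Z a) := by
  refine (dist_le_of_trajectories_ODE_of_mem (s := fun _ => Metric.closedBall 0 R)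
    (fun t ht => hK t (Ico_subset_Icc_self ht))
    hY.continuousOn (fun _ => hasDerivWithinAt_Ici_of_isIntegralCurveOn hY)
    (fun t ht => hYR (Ico_subset_Icc_self ht))
    hZ.continuousOn (fun _ => hasDerivWithinAt_Ici_of_isIntegralCurveOn hZ)
    (fun t ht => hZR (Ico_subset_Icc_self ht)) le_rfl t ht).trans ?_
  rw [mul_comm]
  gcongr
  exact ht.2

theorem eqOn_of_isIntegralCurveOn_Icc [FiniteDimensional ℝ E] (hv : ContDiff ℝ 1 ↿v)
    (hY : IsIntegralCurveOn Y v (Icc a b)) (hZ : IsIntegralCurveOn Z v (Icc a b)) {t₀ : ℝ}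
    (ht₀ : t₀ ∈ Ioo a b) (h : Y t₀ = Z t₀) : EqOn Y Z (Icc a b) := by
  obtain ⟨R₁, hR₁⟩ := exists_mapsTo_closedBall_of_isIntegralCurveOn hY
  obtain ⟨R₂, hR₂⟩ := exists_mapsTo_closedBall_of_isIntegralCurveOn hZ
  obtain ⟨K, hK⟩ := exists_lipschitzOnWith_field hv a b (max R₁ R₂)
  have hderiv : ∀ X : ℝ → E, IsIntegralCurveOn X v (Icc a b) → ∀ t ∈ Ioo a b,
      HasDerivAt X (v t (X t)) t := fun X hX =>
    (isIntegralCurveOn_iff_hasDerivAt isOpen_Ioo).mp (hX.mono Ioo_subset_Icc_self)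
  exact ODE_solution_unique_of_mem_Icc (s := fun _ => Metric.closedBall 0 (max R₁ R₂))
    (fun t ht => hK t (Ioo_subset_Icc_self ht)) ht₀
    hY.continuousOn (hderiv Y hY) (fun t ht => Metric.closedBall_subset_closedBall
      (le_max_left _ _) (hR₁ (Ioo_subset_Icc_self ht)))
    hZ.continuousOn (hderiv Z hZ) (fun t ht => Metric.closedBall_subset_closedBall
      (le_max_right _ _) (hR₂ (Ioo_subset_Icc_self ht))) h

theorem exists_boundedLipschitz_eqOn [ProperSpace E] (hv : Continuous ↿v)
    (hab : a ≤ b) (hY : IsIntegralCurveOn Y v (Icc a b)) :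
    ∃ Z : C(ℝ, E), EqOn Y Z (Icc a b) ∧ ∀ᶠ n in atTop, Z ∈ boundedLipschitz E n := by
  obtain ⟨R, hR⟩ := exists_mapsTo_closedBall_of_isIntegralCurveOn hY
  obtain ⟨M, hM⟩ := exists_lipschitzOnWith_of_isIntegralCurveOn hv a b R
  have hL : LipschitzWith (M * 1) fun t => Y (projIcc a b hab t) :=
    (hM Y hY hR).to_restrict.comp (LipschitzWith.projIcc hab)
  refine ⟨⟨_, hL.continuous⟩, fun t ht => ?_, ?_⟩
  · exact congrArg Y (congrArg Subtype.val (projIcc_of_mem hab ht)).symm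
  · filter_upwards [tendsto_natCast_atTop_atTop.eventually_ge_atTop R,
      tendsto_natCast_atTop_atTop.eventually_ge_atTop (M * 1)] with n hRn hMn
    exact ⟨hL.weaken hMn, fun t =>
      Metric.closedBall_subset_closedBall hRn (hR (projIcc a b hab t).2)⟩

theorem isIntegralCurveOn_congr {s : Set ℝ} (h : EqOn Y Z s) :
    IsIntegralCurveOn Y v s ↔ IsIntegralCurveOn Z v s :=
  forall₂_congr fun t ht => by
    rw [h ht]
    exact ⟨fun hY => hY.congr (fun s hs => (h hs).symm) (h ht).symm,
      fun hZ => hZ.congr h (h ht)⟩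

theorem exists_lipschitzWith_flow [FiniteDimensional ℝ E] (hv : ContDiff ℝ 1 ↿v) (a b R : ℝ) :
    ∃ (L : NNReal) (Φ : E × ℝ → E), LipschitzWith L Φ ∧
      ∀ Z : ℝ → E, IsIntegralCurveOn Z v (Icc a b) → MapsTo Z (Icc a b) (Metric.closedBall 0 R) →
        ∀ t ∈ Icc a b, Φ (Z a, t) = Z t := by
  have : ProperSpace E := FiniteDimensional.proper ℝ E
  obtain ⟨K, hK⟩ := exists_lipschitzOnWith_field hv a b R
  obtain ⟨M, hM⟩ := exists_lipschitzOnWith_of_isIntegralCurveOn hv.continuous a b R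
  let S : Set (ℝ → E) := {Z | IsIntegralCurveOn Z v (Icc a b) ∧
    MapsTo Z (Icc a b) (Metric.closedBall 0 R)}
  have hsol : ∀ z : E, (∃ Z ∈ S, Z a = z) → ∃ Z ∈ S, Z a = z := fun _ h => h
  choose! sol hsolS hsola using hsol
  let L : NNReal := ⟨Real.exp (K * (b - a)), (Real.exp_pos _).le⟩
  have hdist : ∀ Y ∈ S, ∀ Z ∈ S, ∀ t ∈ Icc a b, dist (Y t) (Z t) ≤ L * dist (Y a) (Z a) :=
    fun Y hY Z hZ _ ht => dist_le_of_isIntegralCurveOn hK hY.1 hY.2 hZ.1 hZ.2 ht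
  have hlip : LipschitzOnWith (L + M) (fun p : E × ℝ => sol p.1 p.2)
      {p | (∃ Z ∈ S, Z a = p.1) ∧ p.2 ∈ Icc a b} := by
    refine LipschitzOnWith.of_dist_le_mul fun p hp q hq => ?_
    calc dist (sol p.1 p.2) (sol q.1 q.2)
        ≤ dist (sol p.1 p.2) (sol q.1 p.2) + dist (sol q.1 p.2) (sol q.1 q.2) :=
          dist_triangle _ _ _
      _ ≤ L * dist p.1 q.1 + M * dist p.2 q.2 := by
          gcongr
          · simpa only [hsola _ hp.1, hsola _ hq.1] using
              hdist _ (hsolS _ hp.1) _ (hsolS _ hq.1) _ hp.2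
          · exact (hM _ (hsolS _ hq.1).1 (hsolS _ hq.1).2).dist_le_mul _ hp.2 _ hq.2
      _ ≤ L * dist p q + M * dist p q := by
          gcongr
          · exact le_max_left _ _
          · exact le_max_right _ _
      _ = (L + M : NNReal) * dist p q := by push_cast; ring
  obtain ⟨Φ, hΦ, hΦsol⟩ := hlip.extend_finite_dimension
  refine ⟨_, Φ, hΦ, fun Z hZ hZR t ht => ?_⟩
  have hZS : ∃ Z' ∈ S, Z' a = Z a := ⟨Z, ⟨hZ, hZR⟩, rfl⟩
  rw [← hΦsol ⟨hZS, ht⟩]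
  refine dist_le_zero.mp ((hdist _ (hsolS _ hZS) Z ⟨hZ, hZR⟩ t ht).trans ?_)
  rw [hsola _ hZS, dist_self, mul_zero]

end IntegralCurves

/-! ### Dimension of the samples that an unknown system can match -/

section Dimension

variable {E : Type*} [NormedAddCommGroup E] [NormedSpace ℝ E] [FiniteDimensional ℝ E]

/-- The `N`-tuples of image points `(col, row)` that some solution `Z` of the ODE matches in the
column, if the `i`-th image point is compared with `Z` at the time `s i + c + d * row`; the solution
and the numbers `c`, `d` are unknown. -/
def matchedSamples (v : ℝ → E → E) (col : E → ℝ) (a b : ℝ) {N : ℕ} (s : Fin N → ℝ) :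
    Set (Fin N → ℝ × ℝ) :=
  {w | ∃ Z : ℝ → E, IsIntegralCurveOn Z v (Icc a b) ∧ ∃ c d : ℝ,
    ∀ i, s i + c + d * (w i).2 ∈ Icc a b ∧ (w i).1 = col (Z (s i + c + d * (w i).2))}

theorem lipschitzWith_pi_map {ι α β : Type*} [Fintype ι] [PseudoMetricSpace α]
    [PseudoMetricSpace β] {K : NNReal} {f : α → β} (hf : LipschitzWith K f) :
    LipschitzWith K fun (x : ι → α) i => f (x i) :=
  LipschitzWith.of_dist_le_mul fun x y => (dist_pi_le_iff (by positivity)).mpr fun i =>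
    (hf.dist_le_mul _ _).trans (by gcongr; exact dist_le_pi_dist x y i)

theorem dimH_range_comp_le {E₁ E₂ E₃ E₄ : Type*}
    [NormedAddCommGroup E₁] [NormedSpace ℝ E₁] [FiniteDimensional ℝ E₁]
    [NormedAddCommGroup E₂] [NormedSpace ℝ E₂]
    [NormedAddCommGroup E₃] [NormedSpace ℝ E₃] [FiniteDimensional ℝ E₃]
    [NormedAddCommGroup E₄] [NormedSpace ℝ E₄]
    {f : E₁ → E₂} {Φ : E₂ → E₃} {g : E₃ → E₄} {L : NNReal} (hf : ContDiff ℝ 1 f)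
    (hΦ : LipschitzWith L Φ) (hg : ContDiff ℝ 1 g) :
    dimH (range (g ∘ Φ ∘ f)) ≤ Module.finrank ℝ E₁ := by
  rw [range_comp, range_comp]
  exact (hg.contDiffOn.dimH_image_le convex_univ (subset_univ _)).trans
    ((hΦ.dimH_image_le _).trans hf.dimH_range_le)

theorem dimH_matchedSamples_le {v : ℝ → E → E} (hv : ContDiff ℝ 1 ↿v) {col : E → ℝ}
    (hcol : ContDiff ℝ 1 col) (a b : ℝ) {N : ℕ} (s : Fin N → ℝ) :
    dimH (matchedSamples v col a b s) ≤ (Module.finrank ℝ E + 2 + N : ℕ) := by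
  choose L Φ hΦ hΦsol using fun n : ℕ => exists_lipschitzWith_flow hv a b n
  let times : E × ℝ × ℝ × (Fin N → ℝ) → (Fin N → E × ℝ) × (Fin N → ℝ) := fun p =>
    (fun i => (p.1, s i + p.2.1 + p.2.2.1 * p.2.2.2 i), p.2.2.2)
  let flow : ℕ → (Fin N → E × ℝ) × (Fin N → ℝ) → (Fin N → E) × (Fin N → ℝ) := fun n =>
    Prod.map (fun x i => Φ n (x i)) id
  let samples : (Fin N → E) × (Fin N → ℝ) → Fin N → ℝ × ℝ := fun p i => (col (p.1 i), p.2 i)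
  have htimes : ContDiff ℝ 1 times :=
    (contDiff_pi.mpr fun i => by fun_prop).prodMk (by fun_prop)
  have hsamples : ContDiff ℝ 1 samples := contDiff_pi.mpr fun i => by fun_prop
  have hcover : matchedSamples v col a b s ⊆ ⋃ n, range (samples ∘ flow n ∘ times) := by
    rintro w ⟨Z, hZ, c, d, h⟩
    obtain ⟨R, hR⟩ := exists_mapsTo_closedBall_of_isIntegralCurveOn hZ
    obtain ⟨n, hn⟩ := exists_nat_ge R
    have hZn := hR.mono_right (Metric.closedBall_subset_closedBall hn)
    refine mem_iUnion.mpr ⟨n, (Z a, c, d, fun i => (w i).2), funext fun i => Prod.ext ?_ rfl⟩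
    exact (congrArg col (hΦsol n Z hZ hZn _ (h i).1)).trans (h i).2.symm
  refine (dimH_mono hcover).trans (dimH_iUnion _ |>.trans_le (iSup_le fun n => ?_))
  have hflow : LipschitzWith _ (flow n) :=
    ((lipschitzWith_pi_map (hΦ n)).comp LipschitzWith.prod_fst).prodMk LipschitzWith.prod_snd
  refine (dimH_range_comp_le htimes hflow hsamples).trans_eq ?_
  simp only [Module.finrank_prod, Module.finrank_self, Module.finrank_fin_fun]
  norm_cast
  ring

theorem dense_compl_matchedSamples {v : ℝ → E → E} (hv : ContDiff ℝ 1 ↿v) {col : E → ℝ}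
    (hcol : ContDiff ℝ 1 col) (a b : ℝ) {N : ℕ} (hN : Module.finrank ℝ E + 2 < N)
    (s : Fin N → ℝ) : Dense (matchedSamples v col a b s)ᶜ := by
  refine dense_compl_of_dimH_lt_finrank ((dimH_matchedSamples_le hv hcol a b s).trans_lt ?_)
  simp only [Module.finrank_pi_fintype, Module.finrank_prod, Module.finrank_self,
    Finset.sum_const, Finset.card_univ, Fintype.card_fin, smul_eq_mul]
  norm_cast
  omega

end Dimension

/-! ### Control systems and generic inputs -/

section ControlSystem

variable {V W : Type*} [NormedAddCommGroup V] [NormedSpace ℝ V] [NormedAddCommGroup W]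
  [NormedSpace ℝ W] {F : V → Input → V} {img : V → ℝ × ℝ} {G : W → Input → W} {col : W → ℝ}
  {s₀ : ℝ} {v₀ : V} {α β p q p' q' : ℝ} {u : SmoothInput}

/-- The time-dependent vector field of the control system `x' = F x u` under the input `u`. -/
def SmoothInput.field {V : Type*} (u : SmoothInput) (F : V → Input → V) (t : ℝ) (x : V) : V :=
  F x (u.val t)

theorem SmoothInput.continuous_field {V : Type*} [TopologicalSpace V] {F : V → Input → V}
    (hF : Continuous ↿F) (u : SmoothInput) : Continuous ↿(u.field F) :=
  hF.comp (continuous_snd.prodMk (u.smooth.continuous.comp continuous_fst))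

theorem SmoothInput.contDiff_field {n : ℕ∞} (hF : ContDiff ℝ n ↿F) (u : SmoothInput) :
    ContDiff ℝ n ↿(u.field F) :=
  hF.comp (contDiff_snd.prodMk
    ((u.smooth.of_le (by exact_mod_cast le_top)).comp contDiff_fst))

theorem isIntegralCurveOn_field_congr {w : SmoothInput} {Y : ℝ → V} {s : Set ℝ}
    (h : EqOn w.val u.val s) :
    IsIntegralCurveOn Y (w.field F) s ↔ IsIntegralCurveOn Y (u.field F) s :=
  forall₂_congr fun t ht => by rw [SmoothInput.field, SmoothInput.field, h ht]

theorem isClosed_isIntegralCurveOn_field [CompleteSpace V] (hF : Continuous ↿F) (a b : ℝ) :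
    IsClosed {x : SmoothInput × C(ℝ, V) | IsIntegralCurveOn x.2 (x.1.field F) (Icc a b)} := by
  simp only [isIntegralCurveOn_Icc_iff_integral (SmoothInput.continuous_field hF _)
    (ContinuousMap.continuous _), ofPred_forall]
  have heval : ∀ t : ℝ, Continuous fun x : SmoothInput × C(ℝ, V) => x.2 t := fun t =>
    continuous_snd.eval continuous_const
  refine isClosed_iInter fun t => isClosed_iInter fun _ =>
    isClosed_eq (heval t) ((heval a).add ?_)
  apply intervalIntegral.continuous_parametric_intervalIntegral_of_continuous'
  exact hF.comp (((continuous_snd.comp continuous_fst).eval continuous_snd).prodMk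
    (SmoothInput.continuous_eval.comp
      ((continuous_fst.comp continuous_fst).prodMk continuous_snd)))

/-- The position of the intervals in the genericity conditions: `[p, q]` and the initial time `s₀`
are disjoint parts of `(α, β)`. -/
structure IsWindow (s₀ α β p q : ℝ) : Prop where
  initial : s₀ ∈ Ioo α β
  left : α < p
  lt : p < q
  right : q < β
  initial_notMem : s₀ ∉ Icc p q

theorem IsWindow.Icc_subset (h : IsWindow s₀ α β p q) : Icc p q ⊆ Icc α β :=
  Icc_subset_Icc h.left.le h.right.le

theorem IsWindow.le (h : IsWindow s₀ α β p q) : α ≤ β :=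
  (h.initial.1.trans h.initial.2).le

theorem isWindow_of_Icc_subset {s₁ : ℝ} (hα : α < min s₀ s₁) (hβ : max s₀ s₁ < β) (hpq : p < q)
    (h : Icc p q ⊆ Ioo (min s₀ s₁) (max s₀ s₁)) : IsWindow s₀ α β p q where
  initial := ⟨hα.trans_le (min_le_left _ _), (le_max_left _ _).trans_lt hβ⟩
  left := hα.trans (h (left_mem_Icc.mpr hpq.le)).1
  lt := hpq
  right := (h (right_mem_Icc.mpr hpq.le)).2.trans hβ
  initial_notMem hs₀ := by
    have hs₀ := h hs₀
    rcases le_total s₀ s₁ with hs | hs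
    · exact hs₀.1.ne' (min_eq_left hs).symm
    · exact hs₀.2.ne (max_eq_left hs).symm

variable (F img G col s₀ v₀) in
/-- The inputs under which the solution of the system `F` through `v₀` at time `s₀` shows, on
`[p, q]`, the same columns as some solution of the system `G` shows on `[p', q']`, at times that are
delayed in proportion to the row. -/
def matchedInputs (α β p q p' q' : ℝ) : Set SmoothInput :=
  {u | ∃ Y : ℝ → V, IsIntegralCurveOn Y (u.field F) (Icc α β) ∧ Y s₀ = v₀ ∧
    ∃ Z : ℝ → W, IsIntegralCurveOn Z (u.field G) (Icc p' q') ∧ ∃ c d : ℝ, ∀ s ∈ Icc p q,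
      s + c + d * (img (Y s)).2 ∈ Icc p' q' ∧
        (img (Y s)).1 = col (Z (s + c + d * (img (Y s)).2))}

variable (F img s₀ v₀) in
/-- The inputs under which the solution of the system `F` through `v₀` at time `s₀` shows a constant
row on `[p, q]`. -/
def constantRowInputs (α β p q : ℝ) : Set SmoothInput :=
  {u | ∃ Y : ℝ → V, IsIntegralCurveOn Y (u.field F) (Icc α β) ∧ Y s₀ = v₀ ∧
    ∀ s ∈ Icc p q, (img (Y s)).2 = (img (Y p)).2}

variable (F img s₀ v₀) in
/-- Arbitrarily small changes of the input on `[p, q]` suffice to move finitely many image points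
that the solution through `v₀` at time `s₀` shows there off any set with dense complement. -/
def SamplesPerturbable : Prop :=
  ∀ ⦃α β p q : ℝ⦄, IsWindow s₀ α β p q → ∀ ⦃u : SmoothInput⦄ ⦃Y : ℝ → V⦄,
    IsIntegralCurveOn Y (u.field F) (Icc α β) → Y s₀ = v₀ →
    ∀ ⦃N : ℕ⦄ ⦃s : Fin N → ℝ⦄, s.Injective → (∀ i, s i ∈ Ioo p q) →
    ∀ ⦃E : Set (Fin N → ℝ × ℝ)⦄, Dense Eᶜ →
      ∃ᶠ w : SmoothInput in 𝓝 u, EqOn w.val u.val (Icc p q)ᶜ ∧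
        ∃ Z : ℝ → V, IsIntegralCurveOn Z (w.field F) (Icc α β) ∧ Z s₀ = v₀ ∧
          (fun i => img (Z (s i))) ∉ E

section Meagre

variable [FiniteDimensional ℝ V] [FiniteDimensional ℝ W]

theorem interior_eq_empty_of_samplesPerturbable (hF : ContDiff ℝ 1 ↿F)
    (hP : SamplesPerturbable F img s₀ v₀) (hw : IsWindow s₀ α β p q) {N : ℕ} {s : Fin N → ℝ}
    (hs : s.Injective) (hspq : ∀ i, s i ∈ Ioo p q) {E : SmoothInput → Set (Fin N → ℝ × ℝ)}
    (hE : ∀ u, Dense (E u)ᶜ) (hloc : ∀ u w, EqOn w.val u.val (Icc p q)ᶜ → E w ⊆ E u) :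
    interior {u | ∃ Y : ℝ → V, IsIntegralCurveOn Y (u.field F) (Icc α β) ∧ Y s₀ = v₀ ∧
      (fun i => img (Y (s i))) ∈ E u} = ∅ := by
  rw [eq_empty_iff_forall_notMem]
  intro u hu
  obtain ⟨Y, hY, hY₀, -⟩ := interior_subset hu
  obtain ⟨w, ⟨hwu, Z, hZ, hZ₀, hZE⟩, X, hX, hX₀, hXE⟩ :=
    ((hP hw hY hY₀ hs hspq (hE u)).and_eventually (mem_interior_iff_mem_nhds.mp hu)).exists
  have hXZ : EqOn X Z (Icc α β) :=
    eqOn_of_isIntegralCurveOn_Icc (w.contDiff_field hF) hX hZ hw.initial (hX₀.trans hZ₀.symm)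
  refine hZE (hloc u w hwu ?_)
  simpa only [hXZ (hw.Icc_subset (Ioo_subset_Icc_self (hspq _)))] using hXE

theorem exists_injective_mem_Ioo {p q : ℝ} (hpq : p < q) (N : ℕ) :
    ∃ s : Fin N → ℝ, s.Injective ∧ ∀ i, s i ∈ Ioo p q := by
  have : Infinite (Ioo p q) := (Ioo_infinite hpq).to_subtype
  let e : Fin N ↪ Ioo p q := Fin.valEmbedding.trans (Infinite.natEmbedding _)
  exact ⟨fun i => e i, Subtype.val_injective.comp e.injective, fun i => (e i).2⟩

theorem interior_matchedInputs (hF : ContDiff ℝ 1 ↿F) (hG : ContDiff ℝ 1 ↿G)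
    (hcol : ContDiff ℝ 1 col) (hP : SamplesPerturbable F img s₀ v₀) (hw : IsWindow s₀ α β p q)
    (hdisj : Disjoint (Icc p q) (Icc p' q')) :
    interior (matchedInputs F img G col s₀ v₀ α β p q p' q') = ∅ := by
  obtain ⟨s, hs, hspq⟩ := exists_injective_mem_Ioo hw.lt (Module.finrank ℝ W + 3)
  have hE := fun u : SmoothInput =>
    dense_compl_matchedSamples (u.contDiff_field hG) hcol p' q' (by omega) s
  rw [← subset_empty_iff,
    ← interior_eq_empty_of_samplesPerturbable hF hP hw hs hspq hE fun u w hwu => ?_]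
  · refine interior_mono ?_
    rintro u ⟨Y, hY, hY₀, Z, hZ, c, d, h⟩
    exact ⟨Y, hY, hY₀, Z, hZ, c, d, fun i => h (s i) (Ioo_subset_Icc_self (hspq i))⟩
  · rintro x ⟨Z, hZ, h⟩
    exact ⟨Z, (isIntegralCurveOn_field_congr
      (hwu.mono (subset_compl_iff_disjoint_left.mpr hdisj))).mp hZ, h⟩

theorem dense_compl_setOf_snd_eq : Dense {w : Fin 2 → ℝ × ℝ | (w 0).2 = (w 1).2}ᶜ := by
  let row (i : Fin 2) : (Fin 2 → ℝ × ℝ) →ₗ[ℝ] ℝ :=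
    LinearMap.snd ℝ ℝ ℝ ∘ₗ LinearMap.proj i
  have hker : {w : Fin 2 → ℝ × ℝ | (w 0).2 = (w 1).2} = (LinearMap.ker (row 0 - row 1) : Set _) :=
    Set.ext fun w => sub_eq_zero.symm
  rw [← interior_eq_empty_iff_dense_compl, hker, ← not_nonempty_iff_eq_empty]
  intro hne
  have hmem : ![(0, 1), (0, 0)] ∈ LinearMap.ker (row 0 - row 1) :=
    Submodule.eq_top_of_nonempty_interior' _ hne ▸ Submodule.mem_top
  rw [← SetLike.mem_coe, ← hker] at hmem
  exact one_ne_zero hmem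

theorem interior_constantRowInputs (hF : ContDiff ℝ 1 ↿F) (hP : SamplesPerturbable F img s₀ v₀)
    (hw : IsWindow s₀ α β p q) : interior (constantRowInputs F img s₀ v₀ α β p q) = ∅ := by
  obtain ⟨s, hs, hspq⟩ := exists_injective_mem_Ioo hw.lt 2
  rw [← subset_empty_iff, ← interior_eq_empty_of_samplesPerturbable hF hP hw hs hspq
    (fun _ => dense_compl_setOf_snd_eq) fun _ _ _ => Subset.rfl]
  refine interior_mono ?_
  rintro u ⟨Y, hY, hY₀, h⟩
  exact ⟨Y, hY, hY₀, (h _ (Ioo_subset_Icc_self (hspq 0))).trans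
    (h _ (Ioo_subset_Icc_self (hspq 1))).symm⟩

variable (F img G col s₀ v₀) in
/-- The inputs in `matchedInputs` together with their witnesses, which are extended to all times so
that they form a closed set. -/
def matchings (α β p q p' q' : ℝ) : Set (SmoothInput × C(ℝ, V) × C(ℝ, W) × ℝ × ℝ) :=
  {(u, Y, Z, c, d) | IsIntegralCurveOn Y (u.field F) (Icc α β) ∧ Y s₀ = v₀ ∧
    IsIntegralCurveOn Z (u.field G) (Icc p' q') ∧ ∀ s ∈ Icc p q,
      s + c + d * (img (Y s)).2 ∈ Icc p' q' ∧
        (img (Y s)).1 = col (Z (s + c + d * (img (Y s)).2))}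

theorem isClosed_matchings (hF : Continuous ↿F) (himg : Continuous img) (hG : Continuous ↿G)
    (hcol : Continuous col) : IsClosed (matchings F img G col s₀ v₀ α β p q p' q') := by
  let τ (s : ℝ) (x : SmoothInput × C(ℝ, V) × C(ℝ, W) × ℝ × ℝ) : ℝ :=
    s + x.2.2.2.1 + x.2.2.2.2 * (img (x.2.1 s)).2
  have heval (s : ℝ) : Continuous fun x : SmoothInput × C(ℝ, V) × C(ℝ, W) × ℝ × ℝ => x.2.1 s :=
    continuous_snd.fst.eval continuous_const
  have hτ (s : ℝ) : Continuous (τ s) := by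
    have := himg.comp (heval s)
    fun_prop
  have hmatch : IsClosed {x : SmoothInput × C(ℝ, V) × C(ℝ, W) × ℝ × ℝ | ∀ s ∈ Icc p q,
      τ s x ∈ Icc p' q' ∧ (img (x.2.1 s)).1 = col (x.2.2.1 (τ s x))} := by
    simp only [ofPred_forall]
    exact isClosed_iInter fun s => isClosed_iInter fun _ => (isClosed_Icc.preimage (hτ s)).inter
      (isClosed_eq (himg.comp (heval s)).fst (hcol.comp (continuous_snd.snd.fst.eval (hτ s))))
  exact ((isClosed_isIntegralCurveOn_field hF α β).preimage
    (f := fun x => (x.1, x.2.1)) (by fun_prop)).inter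
    ((isClosed_eq (heval s₀) continuous_const).inter
    (((isClosed_isIntegralCurveOn_field hG p' q').preimage
      (f := fun x => (x.1, x.2.2.1)) (by fun_prop)).inter hmatch))

theorem matchedInputs_eq (hF : Continuous ↿F) (hG : Continuous ↿G) (hw : IsWindow s₀ α β p q) :
    matchedInputs F img G col s₀ v₀ α β p q p' q' =
      {u | ∃ n : ℕ, ∃ z ∈ boundedLipschitz V n ×ˢ boundedLipschitz W n ×ˢ
        Metric.closedBall (0 : ℝ) n ×ˢ Metric.closedBall (0 : ℝ) n,
        (u, z) ∈ matchings F img G col s₀ v₀ α β p q p' q'} := by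
  have : ProperSpace V := FiniteDimensional.proper ℝ V
  have : ProperSpace W := FiniteDimensional.proper ℝ W
  ext u
  refine ⟨?_, fun ⟨_, ⟨Y, Z, c, d⟩, _, hY, hY₀, hZ, h⟩ => ⟨Y, hY, hY₀, Z, hZ, c, d, h⟩⟩
  rintro ⟨Y, hY, hY₀, Z, hZ, c, d, h⟩
  have hpq' : p' ≤ q' := nonempty_Icc.mp ⟨_, (h p (left_mem_Icc.mpr hw.lt.le)).1⟩
  obtain ⟨Y', hYY', hY'⟩ := exists_boundedLipschitz_eqOn (u.continuous_field hF) hw.le hY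
  obtain ⟨Z', hZZ', hZ'⟩ := exists_boundedLipschitz_eqOn (u.continuous_field hG) hpq' hZ
  have hball (r : ℝ) : ∀ᶠ n : ℕ in atTop, r ∈ Metric.closedBall (0 : ℝ) n := by
    simpa only [mem_closedBall_zero_iff] using
      tendsto_natCast_atTop_atTop.eventually_ge_atTop ‖r‖
  obtain ⟨n, hn⟩ := (hY'.and (hZ'.and ((hball c).and (hball d)))).exists
  refine ⟨n, (Y', Z', c, d), hn, (isIntegralCurveOn_congr hYY').mp hY,
    (hYY' (Ioo_subset_Icc_self hw.initial)).symm.trans hY₀,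
    (isIntegralCurveOn_congr hZZ').mp hZ, fun s hs => ?_⟩
  rw [← hYY' (hw.Icc_subset hs), ← hZZ' (h s hs).1]
  exact h s hs

theorem isMeagre_matchedInputs (hF : ContDiff ℝ 1 ↿F) (himg : Continuous img)
    (hG : ContDiff ℝ 1 ↿G) (hcol : ContDiff ℝ 1 col) (hP : SamplesPerturbable F img s₀ v₀)
    (hw : IsWindow s₀ α β p q) (hdisj : Disjoint (Icc p q) (Icc p' q')) :
    IsMeagre (matchedInputs F img G col s₀ v₀ α β p q p' q') := by
  have : ProperSpace V := FiniteDimensional.proper ℝ V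
  have : ProperSpace W := FiniteDimensional.proper ℝ W
  have hint := interior_matchedInputs hF hG hcol hP hw hdisj
  rw [matchedInputs_eq hF.continuous hG.continuous hw] at hint ⊢
  refine isMeagre_exists_mem_of_interior_eq_empty (fun n => ?_)
    (isClosed_matchings hF.continuous himg hG.continuous hcol.continuous) hint
  exact (isCompact_boundedLipschitz V n).prod ((isCompact_boundedLipschitz W n).prod
    ((isCompact_closedBall _ _).prod (isCompact_closedBall _ _)))

theorem constantRowInputs_eq (hF : Continuous ↿F) (hw : IsWindow s₀ α β p q) :
    constantRowInputs F img s₀ v₀ α β p q = {u | ∃ n : ℕ, ∃ Y ∈ boundedLipschitz V n,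
      (u, Y) ∈ {x : SmoothInput × C(ℝ, V) | IsIntegralCurveOn x.2 (x.1.field F) (Icc α β) ∧
        x.2 s₀ = v₀ ∧ ∀ s ∈ Icc p q, (img (x.2 s)).2 = (img (x.2 p)).2}} := by
  have : ProperSpace V := FiniteDimensional.proper ℝ V
  ext u
  refine ⟨?_, fun ⟨_, Y, _, h⟩ => ⟨Y, h⟩⟩
  rintro ⟨Y, hY, hY₀, h⟩
  obtain ⟨Y', hYY', hY'⟩ := exists_boundedLipschitz_eqOn (u.continuous_field hF) hw.le hY
  obtain ⟨n, hn⟩ := hY'.exists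
  refine ⟨n, Y', hn, (isIntegralCurveOn_congr hYY').mp hY,
    (hYY' (Ioo_subset_Icc_self hw.initial)).symm.trans hY₀, fun s hs => ?_⟩
  rw [← hYY' (hw.Icc_subset hs), ← hYY' (hw.Icc_subset (left_mem_Icc.mpr hw.lt.le))]
  exact h s hs

theorem isMeagre_constantRowInputs (hF : ContDiff ℝ 1 ↿F) (himg : Continuous img)
    (hP : SamplesPerturbable F img s₀ v₀) (hw : IsWindow s₀ α β p q) :
    IsMeagre (constantRowInputs F img s₀ v₀ α β p q) := by
  have : ProperSpace V := FiniteDimensional.proper ℝ V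
  have hint := interior_constantRowInputs hF hP hw
  rw [constantRowInputs_eq hF.continuous hw] at hint ⊢
  refine isMeagre_exists_mem_of_interior_eq_empty (isCompact_boundedLipschitz V) ?_ hint
  have heval (s : ℝ) : Continuous fun x : SmoothInput × C(ℝ, V) => x.2 s :=
    continuous_snd.eval continuous_const
  have hrow : IsClosed {x : SmoothInput × C(ℝ, V) | ∀ s ∈ Icc p q,
      (img (x.2 s)).2 = (img (x.2 p)).2} := by
    simp only [ofPred_forall]
    exact isClosed_iInter fun s => isClosed_iInter fun _ =>
      isClosed_eq (himg.comp (heval s)).snd (himg.comp (heval p)).snd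
  exact (isClosed_isIntegralCurveOn_field hF.continuous α β).inter
    ((isClosed_eq (heval s₀) continuous_const).inter hrow)

variable (F img G col s₀ v₀) in
/-- The input lies in none of the countably many exceptional sets with rational end points. -/
def IsGenericInput (u : SmoothInput) : Prop :=
  ∀ α β p q : ℚ, IsWindow s₀ α β p q → u ∉ constantRowInputs F img s₀ v₀ α β p q ∧
    ∀ p' q' : ℚ, Disjoint (Icc (p : ℝ) q) (Icc p' q') →
      u ∉ matchedInputs F img G col s₀ v₀ α β p q p' q'

theorem eventually_isGenericInput (hF : ContDiff ℝ 1 ↿F) (himg : Continuous img)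
    (hG : ContDiff ℝ 1 ↿G) (hcol : ContDiff ℝ 1 col) (hP : SamplesPerturbable F img s₀ v₀) :
    ∀ᶠ u in residual SmoothInput, IsGenericInput F img G col s₀ v₀ u := by
  simp only [IsGenericInput, eventually_countable_forall, eventually_and]
  exact fun α β p q hw => ⟨isMeagre_constantRowInputs hF himg hP hw, fun p' q' hdisj =>
    isMeagre_matchedInputs hF himg hG hcol hP hw hdisj⟩

end Meagre

theorem exists_rat_Icc_subset_of_mem_nhds {S : Set ℝ} {s : ℝ} (hS : S ∈ 𝓝 s) :
    ∃ p q : ℚ, s ∈ Ioo (p : ℝ) q ∧ Icc (p : ℝ) q ⊆ S := by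
  obtain ⟨a, b, hs, hab⟩ := mem_nhds_iff_exists_Ioo_subset.mp hS
  obtain ⟨p, hap, hps⟩ := exists_rat_btwn hs.1
  obtain ⟨q, hsq, hqb⟩ := exists_rat_btwn hs.2
  exact ⟨p, q, ⟨hps, hsq⟩, (Icc_subset_Ioo hap hqb).trans hab⟩

namespace IsGenericInput

variable {s₁ a b a' b' c d s : ℝ} {Y : ℝ → V} {Z : ℝ → W}

theorem exists_isWindow (hY : IsIntegralCurveOn Y (u.field F) (Ioo a b))
    (hs₁ : uIcc s₀ s₁ ⊆ Ioo a b) {S : Set ℝ} (hs : s ∈ Ioo (min s₀ s₁) (max s₀ s₁))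
    (hS : S ∈ 𝓝 s) :
    ∃ α β p q : ℚ, IsWindow s₀ α β p q ∧ IsIntegralCurveOn Y (u.field F) (Icc α β) ∧
      Icc (p : ℝ) q ⊆ S ∩ uIcc s₀ s₁ := by
  obtain ⟨α, haα, hα⟩ := exists_rat_btwn (hs₁ (left_mem_Icc.mpr inf_le_sup)).1
  obtain ⟨β, hβ, hβb⟩ := exists_rat_btwn (hs₁ (right_mem_Icc.mpr inf_le_sup)).2
  obtain ⟨p, q, hpq, hsub⟩ :=
    exists_rat_Icc_subset_of_mem_nhds (inter_mem hS (isOpen_Ioo.mem_nhds hs))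
  exact ⟨α, β, p, q,
    isWindow_of_Icc_subset hα hβ (hpq.1.trans hpq.2) (hsub.trans inter_subset_right),
    hY.mono (Icc_subset_Ioo haα hβb), hsub.trans (inter_subset_inter_right _ Ioo_subset_Icc_self)⟩

theorem time_eq (hu : IsGenericInput F img G col s₀ (Y s₀) u) (himg : Continuous img)
    (hY : IsIntegralCurveOn Y (u.field F) (Ioo a b)) (hs₁ : uIcc s₀ s₁ ⊆ Ioo a b)
    (hZ : IsIntegralCurveOn Z (u.field G) (Ioo a' b'))
    (h : ∀ s ∈ uIcc s₀ s₁, s + c + d * (img (Y s)).2 ∈ Ioo a' b' ∧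
      (img (Y s)).1 = col (Z (s + c + d * (img (Y s)).2)))
    (hs : s ∈ Ioo (min s₀ s₁) (max s₀ s₁)) : s + c + d * (img (Y s)).2 = s := by
  by_contra hne
  have hs' : s ∈ uIcc s₀ s₁ := Ioo_subset_Icc_self hs
  obtain ⟨A, hA, B, hB, hAB⟩ := Filter.disjoint_iff.mp (disjoint_nhds_nhds.mpr hne)
  obtain ⟨p', q', hpq', hsub'⟩ := exists_rat_Icc_subset_of_mem_nhds
    (inter_mem hA (isOpen_Ioo.mem_nhds (h s hs').1))
  have hcont : ContinuousAt (fun s => s + c + d * (img (Y s)).2) s := by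
    have hYs : ContinuousAt Y s :=
      (hY.continuousOn s (hs₁ hs')).continuousAt (isOpen_Ioo.mem_nhds (hs₁ hs'))
    have := himg.continuousAt.comp hYs
    fun_prop
  obtain ⟨α, β, p, q, hw, hYαβ, hpq⟩ :=
    exists_isWindow hY hs₁ hs (inter_mem hB (hcont.preimage_mem_nhds
      (Icc_mem_nhds hpq'.1 hpq'.2)))
  have hdisj : Disjoint (Icc (p : ℝ) q) (Icc p' q') :=
    hAB.symm.mono (fun x hx => (hpq hx).1.1) fun x hx => (hsub' hx).1
  exact (hu α β p q hw).2 p' q' hdisj ⟨Y, hYαβ, rfl, Z,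
    hZ.mono fun x hx => (hsub' hx).2, c, d, fun x hx => ⟨(hpq hx).1.2, (h x (hpq hx).2).2⟩⟩

theorem delay_eq_zero (hu : IsGenericInput F img G col s₀ (Y s₀) u) (himg : Continuous img)
    (hY : IsIntegralCurveOn Y (u.field F) (Ioo a b)) (hs₁ : uIcc s₀ s₁ ⊆ Ioo a b)
    (hne : s₀ ≠ s₁) (hZ : IsIntegralCurveOn Z (u.field G) (Ioo a' b'))
    (h : ∀ s ∈ uIcc s₀ s₁, s + c + d * (img (Y s)).2 ∈ Ioo a' b' ∧
      (img (Y s)).1 = col (Z (s + c + d * (img (Y s)).2))) : d = 0 := by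
  by_contra hd
  obtain ⟨s, hs⟩ := nonempty_Ioo.mpr (min_lt_max.mpr hne)
  obtain ⟨α, β, p, q, hw, hYαβ, hpq⟩ := exists_isWindow hY hs₁ hs (isOpen_Ioo.mem_nhds hs)
  have hrow : ∀ x ∈ Icc (p : ℝ) q, (img (Y x)).2 = -c / d := fun x hx => by
    rw [eq_div_iff hd]
    linear_combination time_eq hu himg hY hs₁ hZ h (hpq hx).1
  exact (hu α β p q hw).1 ⟨Y, hYαβ, rfl, fun x hx =>
    (hrow x hx).trans (hrow p (left_mem_Icc.mpr hw.lt.le)).symm⟩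

end IsGenericInput

end ControlSystem

/-! ### The sensor rig as a smooth control system -/

section Smoothness

attribute [local instance] Matrix.normedAddCommGroup Matrix.normedSpace

variable {X : Type*} [NormedAddCommGroup X] [NormedSpace ℝ X] {n : ℕ∞ω} {z : X}

theorem contDiffAt_mulVec {A : X → Matrix (Fin 3) (Fin 3) ℝ} {f : X → V3}
    (hA : ContDiffAt ℝ n A z) (hf : ContDiffAt ℝ n f z) :
    ContDiffAt ℝ n (fun z => A z *ᵥ f z) z := by
  rw [contDiffAt_pi] at hf ⊢
  simp only [mulVec, dotProduct]
  exact fun i => ContDiffAt.sum fun j _ =>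
    (contDiffAt_pi.mp (contDiffAt_pi.mp hA i) j).mul (hf j)

theorem contDiffAt_crossProduct {f g : X → V3} (hf : ContDiffAt ℝ n f z)
    (hg : ContDiffAt ℝ n g z) : ContDiffAt ℝ n (fun z => f z ⨯₃ g z) z := by
  rw [contDiffAt_pi] at hf hg ⊢
  exact Fin.forall_fin_succ.mpr ⟨((hf 1).mul (hg 2)).sub ((hf 2).mul (hg 1)),
    Fin.forall_fin_two.mpr ⟨((hf 2).mul (hg 0)).sub ((hf 0).mul (hg 2)),
      ((hf 0).mul (hg 1)).sub ((hf 1).mul (hg 0))⟩⟩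

theorem contDiff_RCB : ContDiff ℝ n Calib.RCB := by
  refine contDiff_pi.mpr fun i => contDiff_pi.mpr fun j => ?_
  fin_cases i <;> fin_cases j <;>
  · simp only [Calib.RCB, Fin.zero_eta, Fin.mk_one, Fin.reduceFinMk, of_apply, cons_val]
    fun_prop

theorem contDiff_Ma : ContDiff ℝ n Calib.Ma := by
  refine contDiff_pi.mpr fun i => contDiff_pi.mpr fun j => ?_
  fin_cases i <;> fin_cases j <;>
  · simp only [Calib.Ma, Fin.zero_eta, Fin.mk_one, Fin.reduceFinMk, of_apply, cons_val]
    fun_prop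

variable {θ : X → Calib} {x : X → NavState} {u : X → Input}

theorem contDiffAt_angRate (hθ : ContDiffAt ℝ n θ z) (hu : ContDiffAt ℝ n u z) :
    ContDiffAt ℝ n (fun z => angRate (θ z) (u z)) z :=
  (contDiffAt_mulVec (by fun_prop) (by fun_prop)).sub
    (contDiffAt_mulVec (by fun_prop) (contDiffAt_mulVec (by fun_prop) (by fun_prop)))

theorem contDiffAt_accel (hθ : ContDiffAt ℝ n θ z) (hu : ContDiffAt ℝ n u z) :
    ContDiffAt ℝ n (fun z => accel (θ z) (u z)) z :=
  contDiffAt_mulVec (contDiff_Ma.contDiffAt.comp z hθ) (by fun_prop)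

theorem contDiffAt_landmarkRate (hθ : ContDiffAt ℝ n θ z) (hx : ContDiffAt ℝ n x z)
    (hu : ContDiffAt ℝ n u z) : ContDiffAt ℝ n (fun z => landmarkRate (θ z) (x z) (u z)) z := by
  have hR : ContDiffAt ℝ n (fun z => (θ z).RCB) z := contDiff_RCB.contDiffAt.comp z hθ
  have hγ : ContDiffAt ℝ n (fun z => (![(x z).γ 0, (x z).γ 1, 1] : V3)) z := by
    refine contDiffAt_pi.mpr fun i => ?_
    fin_cases i <;>
    · simp only [Fin.zero_eta, Fin.mk_one, Fin.reduceFinMk, cons_val]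
      fun_prop
  have hp : ContDiffAt ℝ n (fun z => (x z).ρ • (θ z).pCB) z := by fun_prop
  have hρ : ContDiffAt ℝ n (fun z => (x z).ρ) z := by fun_prop
  exact (contDiffAt_crossProduct (contDiffAt_mulVec hR (contDiffAt_angRate hθ hu))
    (hp.sub hγ)).sub (hρ.smul (contDiffAt_mulVec hR (by fun_prop)))

theorem contDiffAt_dyn (hθ : ContDiffAt ℝ n θ z) (hx : ContDiffAt ℝ n x z)
    (hu : ContDiffAt ℝ n u z) : ContDiffAt ℝ n (fun z => dyn (θ z) (x z) (u z)) z := by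
  have hω := contDiffAt_angRate hθ hu
  have hl := contDiffAt_pi.mp (contDiffAt_landmarkRate hθ hx hu)
  refine ContDiffAt.prodMk (contDiffAt_pi.mpr (Fin.forall_fin_two.mpr ⟨?_, ?_⟩))
    (ContDiffAt.prodMk ?_ (ContDiffAt.prodMk ?_ ?_))
  · exact (hl 0).sub (ContDiffAt.mul (by fun_prop) (hl 2))
  · exact (hl 1).sub (ContDiffAt.mul (by fun_prop) (hl 2))
  · exact ContDiffAt.mul (by fun_prop) (hl 2)
  · exact ((contDiffAt_crossProduct (by fun_prop) hω).add (contDiffAt_accel hθ hu)).add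
      (by fun_prop)
  · exact contDiffAt_crossProduct (by fun_prop) hω

/-- The system with the constant parameters as part of the state, so that a solution with unknown
parameters is a solution with unknown initial value. -/
def augDyn (x : NavState × Calib) (u : Input) : NavState × Calib := (dyn x.2 x.1 u, 0)

theorem contDiff_augDyn : ContDiff ℝ n ↿augDyn :=
  contDiff_iff_contDiffAt.mpr fun _ =>
    (contDiffAt_dyn (by fun_prop) (by fun_prop) (by fun_prop)).prodMk contDiffAt_const

theorem contDiff_uncurry_dyn (θ : Calib) : ContDiff ℝ n ↿(dyn θ) :=
  contDiff_iff_contDiffAt.mpr fun _ => contDiffAt_dyn contDiffAt_const (by fun_prop) (by fun_prop)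

theorem contDiff_imgCol : ContDiff ℝ n fun x : NavState × Calib => imgCol x.2 x.1 := by
  unfold imgCol
  fun_prop

theorem continuous_img (θ : Calib) : Continuous fun x => (imgCol θ x, imgRow θ x) := by
  unfold imgCol imgRow
  fun_prop

end Smoothness

/-! ### The camera -/

/-- The image point (column, row) as a function of the landmark direction. -/
def imgMap (θ : Calib) (a : ℝ × ℝ) : ℝ × ℝ :=
  (imgCol θ (![a.1, a.2], 0), imgRow θ (![a.1, a.2], 0))

theorem imgMap_γ (θ : Calib) (x : NavState) :
    imgMap θ (x.γ 0, x.γ 1) = (imgCol θ x, imgRow θ x) := rfl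

/-- The Jacobian matrix of the camera model. -/
def imgJac (θ : Calib) (a : ℝ × ℝ) : Matrix (Fin 2) (Fin 2) ℝ :=
  let r := a.1 ^ 2 + a.2 ^ 2
  let κ := 1 + θ.intr 4 * r + θ.intr 5 * r ^ 2
  let κ' := 2 * θ.intr 4 + 4 * θ.intr 5 * r
  !![θ.intr 0 * (κ + a.1 ^ 2 * κ' + 2 * θ.intr 6 * a.2 + 6 * θ.intr 7 * a.1),
     θ.intr 0 * (a.1 * a.2 * κ' + 2 * θ.intr 6 * a.1 + 2 * θ.intr 7 * a.2);
     θ.intr 1 * (a.1 * a.2 * κ' + 2 * θ.intr 6 * a.1 + 2 * θ.intr 7 * a.2),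
     θ.intr 1 * (κ + a.2 ^ 2 * κ' + 6 * θ.intr 6 * a.2 + 2 * θ.intr 7 * a.1)]

theorem hasStrictFDerivAt_imgMap (θ : Calib) (a : ℝ × ℝ) :
    HasStrictFDerivAt (imgMap θ) (Matrix.toLin (Module.Basis.finTwoProd ℝ)
      (Module.Basis.finTwoProd ℝ) (imgJac θ a)).toContinuousLinearMap a := by
  have h₁ := hasStrictFDerivAt_fst (𝕜 := ℝ) (E := ℝ) (F := ℝ) (p := a)
  have h₂ := hasStrictFDerivAt_snd (𝕜 := ℝ) (E := ℝ) (F := ℝ) (p := a)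
  have hr := (h₁.pow 2).add (h₂.pow 2)
  have hκ := ((hr.const_mul (θ.intr 4)).const_add 1).add ((hr.pow 2).const_mul (θ.intr 5))
  have hcol := ((((h₁.mul hκ).add ((h₁.const_mul (2 * θ.intr 6)).mul h₂)).add
    ((hr.add ((h₁.pow 2).const_mul 2)).const_mul (θ.intr 7))).const_mul (θ.intr 0)).add_const
      (θ.intr 2)
  have hrow := ((((h₂.mul hκ).add ((hr.add ((h₂.pow 2).const_mul 2)).const_mul (θ.intr 6))).add
    ((h₁.const_mul (2 * θ.intr 7)).mul h₂)).const_mul (θ.intr 1)).add_const (θ.intr 3)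
  rw [imgJac, Matrix.toLin_finTwoProd_toContinuousLinearMap]
  refine HasStrictFDerivAt.prodMk ?_ ?_
  · convert hcol using 1
    · simp [imgCol, NavState.γ]
    · refine ContinuousLinearMap.ext fun x => ?_
      simp
      ring
  · convert hrow using 1
    · simp [imgRow, NavState.γ]
    · refine ContinuousLinearMap.ext fun x => ?_
      simp
      ring

theorem map_nhds_imgMap {θ : Calib} {a : ℝ × ℝ} (ha : (imgJac θ a).det ≠ 0) :
    map (imgMap θ) (𝓝 a) = 𝓝 (imgMap θ a) := by
  refine (hasStrictFDerivAt_imgMap θ a).map_nhds_eq_of_surj ?_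
  rw [LinearMap.coe_toContinuousLinearMap, ← LinearMap.isUnit_iff_range_eq_top,
    LinearMap.isUnit_iff_isUnit_det, LinearMap.det_toLin]
  exact ha.isUnit

/-- Along the ray through `a` the Jacobian determinant is a polynomial that does not vanish
at `0`. -/
theorem frequently_det_imgJac_ne_zero {θ : Calib} (hx : θ.intr 0 ≠ 0) (hy : θ.intr 1 ≠ 0)
    (a : ℝ × ℝ) : ∃ᶠ b in 𝓝 a, (imgJac θ b).det ≠ 0 := by
  have hf : AnalyticOnNhd ℝ (fun t : ℝ => (imgJac θ (t * a.1, t * a.2)).det) univ := by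
    intro t _
    simp only [imgJac, det_fin_two_of]
    fun_prop
  have hne : ∀ᶠ t in 𝓝[≠] (1 : ℝ), (imgJac θ (t * a.1, t * a.2)).det ≠ 0 := by
    refine ((hf 1 (mem_univ 1)).eventually_eq_zero_or_eventually_ne_zero).resolve_left fun h => ?_
    have h0 := hf.eqOn_zero_of_preconnected_of_eventuallyEq_zero isPreconnected_univ (mem_univ 1)
      h (mem_univ 0)
    simp [imgJac, hx, hy] at h0
  have hcont : Tendsto (fun t : ℝ => (t * a.1, t * a.2)) (𝓝 1) (𝓝 a) :=
    Continuous.tendsto' (by fun_prop) _ _ (by simp)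
  exact (hcont.mono_left nhdsWithin_le_nhds).frequently hne.frequently

theorem interior_image_imgMap_nonempty {θ : Calib} (hx : θ.intr 0 ≠ 0) (hy : θ.intr 1 ≠ 0)
    {a : ℝ × ℝ} {V : Set (ℝ × ℝ)} (hV : V ∈ 𝓝 a) : (interior (imgMap θ '' V)).Nonempty := by
  obtain ⟨b, hb, hbV⟩ := ((frequently_det_imgJac_ne_zero hx hy a).and_eventually
    (eventually_mem_nhds_iff.mpr hV)).exists
  refine ⟨imgMap θ b, mem_interior_iff_mem_nhds.mpr ?_⟩
  rw [← map_nhds_imgMap hb]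
  exact image_mem_map hbV

/-! ### Families of smooth inputs -/

section TimeDeriv

variable {P E : Type*} [NormedAddCommGroup E] [NormedSpace ℝ E] {f : P × ℝ → E}

/-- The derivative in time of a curve that depends on a parameter. -/
def timeDeriv (f : P × ℝ → E) (z : P × ℝ) : E := deriv (fun t => f (z.1, t)) z.2

theorem timeDeriv_eq_zero {c : P} {s : Set ℝ} (hs : IsOpen s) (h : ∀ t ∈ s, f (c, t) = 0) {t : ℝ}
    (ht : t ∈ s) : timeDeriv f (c, t) = 0 := by
  have h0 : (fun t => f (c, t)) =ᶠ[𝓝 t] fun _ => 0 := eventually_of_mem (hs.mem_nhds ht) h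
  rw [timeDeriv, h0.deriv_eq, deriv_const]

theorem iteratedDeriv_eq_iterate_timeDeriv (f : P × ℝ → E) (c : P) (k : ℕ) :
    (iteratedDeriv k fun t => f (c, t)) = fun t => timeDeriv^[k] f (c, t) := by
  rw [iteratedDeriv_eq_iterate]
  induction k generalizing f with
  | zero => rfl
  | succ _ ih => exact ih (timeDeriv f)

variable [NormedAddCommGroup P] [NormedSpace ℝ P] {z : P × ℝ}

theorem contDiffAt_timeDeriv (hf : ContDiffAt ℝ ∞ f z) : ContDiffAt ℝ ∞ (timeDeriv f) z := by
  have hf' : ContDiffAt ℝ ∞ (fun p : (P × ℝ) × ℝ => f (p.1.1, p.2)) (z, z.2) :=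
    hf.comp (z, z.2) (contDiff_fst.fst.prodMk contDiff_snd).contDiffAt
  have h := (hf'.fderiv (f := fun z t => f (z.1, t)) contDiffAt_snd (m := ∞) (by simp)).clm_apply
    (contDiffAt_const (c := (1 : ℝ)))
  simp only [fderiv_apply_one_eq_deriv] at h
  exact h

theorem hasDerivAt_timeDeriv (hf : ContDiffAt ℝ ∞ f z) :
    HasDerivAt (fun t => f (z.1, t)) (timeDeriv f z) z.2 :=
  have h : ContDiffAt ℝ ∞ (fun t => f (z.1, t)) z.2 :=
    hf.comp z.2 (contDiffAt_const.prodMk contDiffAt_id)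
  (h.differentiableAt (by simp)).hasDerivAt

theorem contDiff_iterate_timeDeriv (hf : ContDiff ℝ ∞ f) (k : ℕ) :
    ContDiff ℝ ∞ (timeDeriv^[k] f) := by
  induction k generalizing f with
  | zero => exact hf
  | succ _ ih =>
    exact ih (contDiff_iff_contDiffAt.mpr fun _ => contDiffAt_timeDeriv hf.contDiffAt)

/-- The smooth inputs `f (c, ·)`, parametrised by `c`. -/
def SmoothInput.family (f : P × ℝ → Input) (hf : ContDiff ℝ ∞ f) (c : P) : SmoothInput :=
  ⟨fun t => f (c, t), hf.comp (contDiff_const.prodMk contDiff_id)⟩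

theorem SmoothInput.continuous_family {f : P × ℝ → Input} (hf : ContDiff ℝ ∞ f) :
    Continuous (SmoothInput.family f hf) := by
  refine continuous_induced_rng.mpr (continuous_pi fun k => ?_)
  refine ContinuousMap.continuous_of_continuous_uncurry _ ?_
  have h : ∀ c t, (family f hf c).deriv k t = timeDeriv^[k] f (c, t) := fun c =>
    congrFun (iteratedDeriv_eq_iterate_timeDeriv f c k)
  exact (contDiff_iterate_timeDeriv hf k).continuous.congr fun z => (h z.1 z.2).symm

end TimeDeriv

/-! ### Prescribed variations of the landmark direction -/

theorem RCB_mul_transpose (θ : Calib) : θ.RCB * θ.RCBᵀ = (θ.qCB ⬝ᵥ θ.qCB) ^ 2 • 1 := by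
  ext i j
  fin_cases i <;> fin_cases j <;>
  · simp [Calib.RCB, mul_apply, Fin.sum_univ_three, dotProduct, Fin.sum_univ_four]
    ring1

theorem det_RCB_ne_zero {θ : Calib} (hq : θ.qCB ≠ 0) : θ.RCB.det ≠ 0 := by
  have h := congrArg det (RCB_mul_transpose θ)
  rw [det_mul, det_smul, det_one, mul_one] at h
  exact left_ne_zero_of_mul (h ▸ pow_ne_zero _ (pow_ne_zero _ (dotProduct_self_eq_zero.not.mpr hq)))

/-- A variation of the direction `γ`, as a vector of `ℝ³`. -/
def hat (η : Fin 2 → ℝ) : V3 := ![η 0, η 1, 0]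

theorem hat_zero : hat 0 = 0 := by simp [hat]

theorem angRate_add (θ : Calib) (u : Input) (a : V3) :
    angRate θ (u + (a, θ.Ts *ᵥ a)) = angRate θ u := by
  simp only [angRate, Prod.fst_add, Prod.snd_add, add_sub_right_comm, mulVec_add]
  abel

theorem landmarkRate_add (θ : Calib) (x : NavState) (u : Input) (η : Fin 2 → ℝ) (w a : V3) :
    landmarkRate θ (x + (η, 0, w, 0)) (u + (a, θ.Ts *ᵥ a)) =
      landmarkRate θ x u - ((θ.RCB *ᵥ angRate θ u) ⨯₃ hat η + x.ρ • θ.RCB *ᵥ w) := by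
  have hγ : ![(x.γ + η) 0, (x.γ + η) 1, 1] = (![x.γ 0, x.γ 1, 1] + hat η : V3) := by
    simp [hat]
  simp only [landmarkRate, angRate_add, NavState.γ, NavState.ρ, NavState.v, Prod.fst_add,
    Prod.snd_add, add_zero, mulVec_add] at hγ ⊢
  rw [hγ]
  simp only [map_sub, map_add, smul_add]
  abel

theorem dyn_add {θ : Calib} {x : NavState} {u : Input} {η η' : Fin 2 → ℝ} {w : V3}
    (h : x.ρ • θ.RCB *ᵥ w =
      -((θ.RCB *ᵥ angRate θ u) ⨯₃ hat η + landmarkRate θ x u 2 • hat η + hat η')) (a : V3) :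
    dyn θ (x + (η, 0, w, 0)) (u + (a, θ.Ts *ᵥ a)) =
      dyn θ x u + (η', 0, w ⨯₃ angRate θ u + θ.Ma *ᵥ a, 0) := by
  have hl : landmarkRate θ (x + (η, 0, w, 0)) (u + (a, θ.Ts *ᵥ a)) =
      landmarkRate θ x u + landmarkRate θ x u 2 • hat η + hat η' := by
    rw [landmarkRate_add, h]
    abel
  have ha : accel θ (u + (a, θ.Ts *ᵥ a)) = accel θ u + θ.Ma *ᵥ a := by
    rw [accel, accel, Prod.fst_add, add_sub_right_comm, mulVec_add]
  have hdir (i : Fin 3) : landmarkRate θ (x + (η, 0, w, 0)) (u + (a, θ.Ts *ᵥ a)) i =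
      landmarkRate θ x u i + landmarkRate θ x u 2 * hat η i + hat η' i := congrFun hl i
  simp only [dyn, ha, angRate_add, hdir]
  refine Prod.ext (funext (Fin.forall_fin_two.mpr ⟨?_, ?_⟩)) (Prod.ext ?_ (Prod.ext ?_ ?_))
  · simp only [hat, NavState.γ, Prod.fst_add, Pi.add_apply, cons_val]
    ring
  · simp only [hat, NavState.γ, Prod.fst_add, Pi.add_apply, cons_val]
    ring
  · simp [hat, NavState.ρ]
  · simp only [NavState.v, NavState.g, Prod.fst_add, Prod.snd_add, map_add, LinearMap.add_apply,
      add_zero]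
    abel
  · simp [NavState.g]

section Variation

attribute [local instance] Matrix.normedAddCommGroup Matrix.normedSpace

variable {P : Type*} (θ : Calib) (u : SmoothInput) (x : ℝ → NavState) (η : P × ℝ → Fin 2 → ℝ)

/-- The variation of the velocity that accompanies a family `η` of variations of the direction in
such a way that the depth does not change. -/
def velVar (z : P × ℝ) : V3 :=
  -((x z.2).ρ⁻¹ • θ.RCB⁻¹ *ᵥ ((θ.RCB *ᵥ angRate θ (u.val z.2)) ⨯₃ hat (η z) +
    landmarkRate θ (x z.2) (u.val z.2) 2 • hat (η z) + hat (timeDeriv η z)))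

/-- The variation of the accelerometer reading that produces the variation `velVar` of the
velocity. -/
def accVar (z : P × ℝ) : V3 :=
  θ.Ma⁻¹ *ᵥ (timeDeriv (velVar θ u x η) z - velVar θ u x η z ⨯₃ angRate θ (u.val z.2))

/-- The input that produces the family `η` of variations of the direction; its gyroscope readings
compensate for the sensitivity `T_s` to the accelerations. -/
def variedInput (z : P × ℝ) : Input :=
  u.val z.2 + (accVar θ u x η z, θ.Ts *ᵥ accVar θ u x η z)

/-- The trajectory with the family `η` of variations of the direction. -/
def variedState (z : P × ℝ) : NavState := x z.2 + (η z, 0, velVar θ u x η z, 0)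

variable {θ u x η}

theorem velVar_eq_zero {c : P} {s : Set ℝ} (hs : IsOpen s) (h : ∀ t ∈ s, η (c, t) = 0) {t : ℝ}
    (ht : t ∈ s) : velVar θ u x η (c, t) = 0 := by
  simp only [velVar, h t ht, timeDeriv_eq_zero hs h ht, hat_zero, map_zero, smul_zero, add_zero,
    mulVec_zero, neg_zero]

theorem variedInput_eq {c : P} {s : Set ℝ} (hs : IsOpen s) (h : ∀ t ∈ s, η (c, t) = 0) {t : ℝ}
    (ht : t ∈ s) : variedInput θ u x η (c, t) = u.val t := by
  have hw : ∀ t ∈ s, velVar θ u x η (c, t) = 0 := fun t ht => velVar_eq_zero hs h ht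
  simp [variedInput, accVar, hw t ht, timeDeriv_eq_zero hs hw ht]

theorem variedState_eq {c : P} {s : Set ℝ} (hs : IsOpen s) (h : ∀ t ∈ s, η (c, t) = 0) {t : ℝ}
    (ht : t ∈ s) : variedState θ u x η (c, t) = x t := by
  simp [variedState, h t ht, velVar_eq_zero hs h ht]

theorem contDiff_hat {n : ℕ∞ω} : ContDiff ℝ n hat :=
  contDiff_pi.mpr <| Fin.forall_fin_succ.mpr ⟨contDiff_apply ℝ ℝ 0,
    Fin.forall_fin_two.mpr ⟨contDiff_apply ℝ ℝ 1, contDiff_const⟩⟩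

variable [NormedAddCommGroup P] [NormedSpace ℝ P] {z : P × ℝ}

theorem contDiffAt_velVar (hx : ContDiffAt ℝ ∞ x z.2) (hρ : (x z.2).ρ ≠ 0)
    (hη : ContDiffAt ℝ ∞ η z) : ContDiffAt ℝ ∞ (velVar θ u x η) z := by
  have hu : ContDiffAt ℝ ∞ (fun z : P × ℝ => u.val z.2) z :=
    u.smooth.contDiffAt.comp z contDiffAt_snd
  have hx' : ContDiffAt ℝ ∞ (fun z : P × ℝ => x z.2) z := hx.comp z contDiffAt_snd
  have hω := contDiffAt_mulVec (contDiffAt_const (c := θ.RCB))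
    (contDiffAt_angRate (contDiffAt_const (c := θ)) hu)
  have hl := contDiffAt_pi.mp (contDiffAt_landmarkRate (contDiffAt_const (c := θ)) hx' hu) 2
  have hhat := contDiff_hat.contDiffAt.comp z hη
  have hhat' := contDiff_hat.contDiffAt.comp z (contDiffAt_timeDeriv hη)
  exact ((contDiffAt_fst.comp z (contDiffAt_snd.comp z hx')).inv hρ).smul (contDiffAt_mulVec
    contDiffAt_const (((contDiffAt_crossProduct hω hhat).add (hl.smul hhat)).add hhat')) |>.neg

theorem contDiffAt_variedInput (hx : ContDiffAt ℝ ∞ x z.2) (hρ : (x z.2).ρ ≠ 0)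
    (hη : ContDiffAt ℝ ∞ η z) : ContDiffAt ℝ ∞ (variedInput θ u x η) z := by
  have hu : ContDiffAt ℝ ∞ (fun z : P × ℝ => u.val z.2) z :=
    u.smooth.contDiffAt.comp z contDiffAt_snd
  have hw := contDiffAt_velVar (θ := θ) (u := u) hx hρ hη
  have ha : ContDiffAt ℝ ∞ (accVar θ u x η) z := contDiffAt_mulVec contDiffAt_const
    ((contDiffAt_timeDeriv hw).sub
      (contDiffAt_crossProduct hw (contDiffAt_angRate contDiffAt_const hu)))
  exact hu.add (ha.prodMk (contDiffAt_mulVec contDiffAt_const ha))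

theorem hasDerivAt_variedState (hR : θ.RCB.det ≠ 0) (hMa : θ.Ma.det ≠ 0)
    (hx : ContDiffAt ℝ ∞ x z.2) (hx' : HasDerivAt x (dyn θ (x z.2) (u.val z.2)) z.2)
    (hρ : (x z.2).ρ ≠ 0) (hη : ContDiffAt ℝ ∞ η z) :
    HasDerivAt (fun t => variedState θ u x η (z.1, t))
      (dyn θ (variedState θ u x η z) (variedInput θ u x η z)) z.2 := by
  have hRw : (x z.2).ρ • θ.RCB *ᵥ velVar θ u x η z =
      -((θ.RCB *ᵥ angRate θ (u.val z.2)) ⨯₃ hat (η z) +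
        landmarkRate θ (x z.2) (u.val z.2) 2 • hat (η z) + hat (timeDeriv η z)) := by
    rw [velVar, mulVec_neg, mulVec_smul, mulVec_mulVec, mul_nonsing_inv _ hR.isUnit, one_mulVec,
      smul_neg, smul_inv_smul₀ hρ]
  have hMaa : velVar θ u x η z ⨯₃ angRate θ (u.val z.2) + θ.Ma *ᵥ accVar θ u x η z =
      timeDeriv (velVar θ u x η) z := by
    rw [accVar, mulVec_mulVec, mul_nonsing_inv _ hMa.isUnit, one_mulVec, add_sub_cancel]
  have h := hx'.add <| (hasDerivAt_timeDeriv hη).prodMk <|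
    (hasDerivAt_const z.2 (0 : ℝ)).prodMk <|
      (hasDerivAt_timeDeriv (contDiffAt_velVar (θ := θ) (u := u) hx hρ hη)).prodMk
        (hasDerivAt_const z.2 (0 : V3))
  rw [← hMaa, ← dyn_add hRw] at h
  exact h

theorem contDiffOn_of_isIntegralCurveOn {α β : ℝ}
    (hx : IsIntegralCurveOn x (u.field (dyn θ)) (Icc α β)) : ContDiffOn ℝ ∞ x (Icc α β) :=
  ODE.contDiffOn_enat_Icc_of_hasDerivWithinAt (u := univ)
    (u.contDiff_field (contDiff_uncurry_dyn θ)).contDiffOn hx (mapsTo_univ _ _)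

theorem depth_ne_zero_of_isIntegralCurveOn {α β : ℝ}
    (hx : IsIntegralCurveOn x (u.field (dyn θ)) (Icc α β)) {s₀ : ℝ} (hs₀ : s₀ ∈ Icc α β)
    (hρ : (x s₀).ρ ≠ 0) {t : ℝ} (ht : t ∈ Ioo α β) : (x t).ρ ≠ 0 := by
  -- `ρ` solves a linear equation along `x`, as does the zero function.
  let F : NavState × ℝ → Input → NavState × ℝ := fun y u =>
    (dyn θ y.1 u, -y.2 * landmarkRate θ y.1 u 2)
  have hF : ContDiff ℝ 1 ↿F := contDiff_iff_contDiffAt.mpr fun _ =>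
    (contDiffAt_dyn contDiffAt_const (by fun_prop) (by fun_prop)).prodMk
      (ContDiffAt.mul (by fun_prop) (contDiffAt_pi.mp
        (contDiffAt_landmarkRate contDiffAt_const (by fun_prop) (by fun_prop)) 2))
  have hY : IsIntegralCurveOn (fun s => (x s, (x s).ρ)) (u.field F) (Icc α β) := fun s hs =>
    (hx s hs).prodMk (hx s hs).snd.fst
  have hZ : IsIntegralCurveOn (fun s => (x s, (0 : ℝ))) (u.field F) (Icc α β) := fun s hs =>
    (hx s hs).prodMk ((hasDerivWithinAt_const _ _ _).congr_deriv (by simp))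
  intro h
  have heq := eqOn_of_isIntegralCurveOn_Icc (u.contDiff_field hF) hY hZ ht (Prod.ext rfl h) hs₀
  exact hρ (congrArg Prod.snd heq)

theorem exists_input_family (hR : θ.RCB.det ≠ 0) (hMa : θ.Ma.det ≠ 0) {α β p q : ℝ} (hp : α < p)
    (hq : q < β) (hx : IsIntegralCurveOn x (u.field (dyn θ)) (Icc α β))
    (hρ : ∀ t ∈ Icc p q, (x t).ρ ≠ 0) (hη : ContDiff ℝ ∞ η) (hη₀ : ∀ t, η (0, t) = 0)
    (hpq : ∀ c, ∀ t ∉ Icc p q, η (c, t) = 0) :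
    ∃ U : P → SmoothInput, Continuous U ∧ U 0 = u ∧ ∀ c, EqOn (U c).val u.val (Icc p q)ᶜ ∧
      ∃ Z, IsIntegralCurveOn Z ((U c).field (dyn θ)) (Icc α β) ∧ EqOn Z x (Icc p q)ᶜ ∧
        ∀ t, (Z t).γ = (x t).γ + η (c, t) := by
  have hO : IsOpen (Icc p q)ᶜ := isClosed_Icc.isOpen_compl
  have hmem : ∀ {t}, t ∈ Icc p q → Icc α β ∈ 𝓝 t := fun ht =>
    Icc_mem_nhds (hp.trans_le ht.1) (ht.2.trans_lt hq)
  have hx' : ∀ {t}, t ∈ Icc p q → ContDiffAt ℝ ∞ x t := fun ht =>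
    (contDiffOn_of_isIntegralCurveOn hx).contDiffAt (hmem ht)
  have hU : ContDiff ℝ ∞ (variedInput θ u x η) := by
    refine contDiff_iff_contDiffAt.mpr fun z => ?_
    by_cases hz : z.2 ∈ Icc p q
    · exact contDiffAt_variedInput (hx' hz) (hρ _ hz) hη.contDiffAt
    · refine (u.smooth.comp contDiff_snd).contDiffAt.congr_of_eventuallyEq ?_
      filter_upwards [(hO.preimage continuous_snd).mem_nhds hz] with w hw
      exact variedInput_eq hO (hpq w.1) hw
  refine ⟨SmoothInput.family _ hU, SmoothInput.continuous_family hU, ?_, fun c =>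
    ⟨fun t => variedInput_eq hO (hpq c), fun t => variedState θ u x η (c, t), fun t ht => ?_,
      fun t => variedState_eq hO (hpq c), fun _ => rfl⟩⟩
  · have h : (fun t => variedInput θ u x η (0, t)) = u.val :=
      funext fun t => variedInput_eq isOpen_univ (fun t _ => hη₀ t) (mem_univ t)
    simp only [SmoothInput.family, h]
  · by_cases htp : t ∈ Icc p q
    · exact (hasDerivAt_variedState (z := (c, t)) hR hMa (hx' htp) ((hx t ht).hasDerivAt (hmem htp))
        (hρ t htp) hη.contDiffAt).hasDerivWithinAt
    · have heq : (fun t => variedState θ u x η (c, t)) =ᶠ[𝓝 t] x :=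
        eventually_of_mem (hO.mem_nhds htp) fun t => variedState_eq hO (hpq c)
      have h := (hx t ht).congr_of_eventuallyEq (heq.filter_mono nhdsWithin_le_nhds)
        heq.self_of_nhds
      refine h.congr_deriv ?_
      simp only [SmoothInput.field, SmoothInput.family, variedInput_eq hO (hpq c) htp,
        variedState_eq hO (hpq c) htp]

end Variation

theorem exists_contDiff_interpolation {ι E : Type*} [Fintype ι] [NormedAddCommGroup E]
    [NormedSpace ℝ E] {s : ι → ℝ} (hs : s.Injective) {O : Set ℝ} (hO : IsOpen O)
    (hsO : ∀ i, s i ∈ O) :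
    ∃ η : (ι → E) × ℝ → E, ContDiff ℝ ∞ η ∧ (∀ t, η (0, t) = 0) ∧
      (∀ c, ∀ t ∉ O, η (c, t) = 0) ∧ ∀ c i, η (c, s i) = c i := by
  classical
  have hnhds (i : ι) : O ∩ (s '' {i}ᶜ)ᶜ ∈ 𝓝 (s i) :=
    (hO.inter (toFinite _).isClosed.isOpen_compl).mem_nhds
      ⟨hsO i, fun ⟨_, hj, hji⟩ => hj (hs hji)⟩
  choose ψ hsupp _ hψ _ hψ₁ using fun i => exists_contDiff_tsupport_subset (n := ⊤) (hnhds i)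
  have hψ₀ : ∀ i, ∀ t ∉ O ∩ (s '' {i}ᶜ)ᶜ, ψ i t = 0 := fun i t ht =>
    image_eq_zero_of_notMem_tsupport fun h => ht (hsupp i h)
  refine ⟨fun z => ∑ i, ψ i z.2 • z.1 i, ContDiff.sum fun i _ => ?_, fun t => by simp,
    fun c t ht => Finset.sum_eq_zero fun i _ => ?_, fun c i => ?_⟩
  · exact ((hψ i).comp contDiff_snd).smul ((contDiff_apply ℝ E i).comp contDiff_fst)
  · rw [hψ₀ i t fun h => ht h.1, zero_smul]
  · refine (Finset.sum_eq_single i (fun j _ hj => ?_) (by simp)).trans (by rw [hψ₁, one_smul])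
    rw [hψ₀ j (s i) fun h => h.2 ⟨i, hj.symm, rfl⟩, zero_smul]

theorem frequently_imgMap_notMem {θ : Calib} (hx : θ.intr 0 ≠ 0) (hy : θ.intr 1 ≠ 0) {ι : Type*}
    [Finite ι] {E : Set (ι → ℝ × ℝ)} (hE : Dense Eᶜ) (a₀ : ι → ℝ × ℝ) :
    ∃ᶠ a in 𝓝 a₀, (fun i => imgMap θ (a i)) ∉ E := by
  refine frequently_iff.mpr fun {U} hU => ?_
  rw [nhds_pi, mem_pi'] at hU
  obtain ⟨I, V, hV, hVU⟩ := hU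
  obtain ⟨z, hzE, hz⟩ := hE.exists_mem_open
    (isOpen_set_pi finite_univ fun i _ => isOpen_interior (s := imgMap θ '' V i))
    (univ_pi_nonempty_iff.mpr fun i => interior_image_imgMap_nonempty hx hy (hV i))
  choose a haV ha using fun i => interior_subset (hz i trivial)
  exact ⟨a, hVU fun i _ => haV i, (funext ha : (fun i => imgMap θ (a i)) = z) ▸ hzE⟩

theorem samplesPerturbable {θ : Calib} (hR : θ.RCB.det ≠ 0) (hMa : θ.Ma.det ≠ 0)
    (hfx : θ.intr 0 ≠ 0) (hfy : θ.intr 1 ≠ 0) {v₀ : NavState} (hρ : v₀.ρ ≠ 0) (s₀ : ℝ) :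
    SamplesPerturbable (dyn θ) (fun x => (imgCol θ x, imgRow θ x)) s₀ v₀ := by
  intro α β p q hw u x hx hx₀ N s hs hspq E hE
  obtain ⟨η, hη, hη₀, hηpq, hηs⟩ :=
    exists_contDiff_interpolation (E := Fin 2 → ℝ) hs isOpen_Ioo hspq
  have hρpq : ∀ t ∈ Icc p q, (x t).ρ ≠ 0 := fun t ht =>
    depth_ne_zero_of_isIntegralCurveOn hx (Ioo_subset_Icc_self hw.initial) (hx₀ ▸ hρ)
      ⟨hw.left.trans_le ht.1, ht.2.trans_lt hw.right⟩
  obtain ⟨U, hU, hU₀, hUZ⟩ := exists_input_family hR hMa hw.left hw.right hx hρpq hη hη₀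
    fun c t ht => hηpq c t fun h => ht (Ioo_subset_Icc_self h)
  let c (a : Fin N → ℝ × ℝ) (i : Fin N) : Fin 2 → ℝ := ![(a i).1, (a i).2] - (x (s i)).γ
  have hc : Tendsto c (𝓝 fun i => ((x (s i)).γ 0, (x (s i)).γ 1)) (𝓝 0) := by
    refine Continuous.tendsto' (by fun_prop) _ _ (funext fun i => ?_)
    exact sub_eq_zero.mpr (funext (Fin.forall_fin_two.mpr ⟨rfl, rfl⟩))
  refine ((hU.tendsto' 0 u hU₀).comp hc).frequently <|
    (frequently_imgMap_notMem hfx hfy hE _).mono fun a ha => ?_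
  obtain ⟨hUu, Z, hZ, hZx, hZγ⟩ := hUZ (c a)
  refine ⟨hUu, Z, hZ, (hZx hw.initial_notMem).trans hx₀, ?_⟩
  have hγ (i : Fin N) : (Z (s i)).γ = ![(a i).1, (a i).2] := by
    rw [hZγ, hηs, add_sub_cancel]
  simpa only [← imgMap_γ, hγ, cons_val_zero, cons_val_one] using ha

/-! ### Rolling-shutter records -/

section Records

attribute [local instance] Matrix.normedAddCommGroup Matrix.normedSpace

variable {n : ℕ} {h : Calib → NavState → Fin (n + 2) → ℝ} {H κ t₀ T : ℝ} {ξ ξ' : FullState}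
  {u : SmoothInput} {y : ℝ → Fin (n + 2) → ℝ}

/-- The readout time is determined by the record for generic inputs: all smooth inputs outside a
meagre set distinguish `ξ` from all full states with another readout time, not only from those in a
neighbourhood of `ξ`, on any time interval, however short. -/
def ReadoutGenericallyDetermined {n : ℕ} (h : Calib → NavState → Fin (n + 2) → ℝ) (H κ t₀ : ℝ)
    (ξ : FullState) : Prop :=
  ∀ᶠ u in residual SmoothInput, ∀ T : ℝ, 0 < T → ∀ y : ℝ → Fin (n + 2) → ℝ,
    IsRecord h H κ t₀ T ξ u y → ∀ ξ', IsRecord h H κ t₀ T ξ' u y → ξ'.tr = ξ.tr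

theorem ReadoutGenericallyDetermined.observable (hξ : ReadoutGenericallyDetermined h H κ t₀ ξ) :
    ReadoutGenericallyObservable h H κ t₀ ξ :=
  hξ.mono fun _ hu T hT y hy => ⟨univ, univ_mem, fun ξ' _ => hu T hT y hy ξ'⟩

theorem eventually_isGenericInput_dyn {θ : Calib} (hq : θ.qCB ≠ 0) (hMa : θ.Ma.det ≠ 0)
    (hfx : θ.intr 0 ≠ 0) (hfy : θ.intr 1 ≠ 0) {x : NavState} (hρ : x.ρ ≠ 0) (s₀ : ℝ) :
    ∀ᶠ u in residual SmoothInput, IsGenericInput (dyn θ) (fun x => (imgCol θ x, imgRow θ x)) augDyn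
      (fun w => imgCol w.2 w.1) s₀ x u :=
  eventually_isGenericInput (contDiff_uncurry_dyn θ) (continuous_img θ) contDiff_augDyn
    contDiff_imgCol (samplesPerturbable (det_RCB_ne_zero hq) hMa hfx hfy hρ s₀)

theorem rsTime_eq_rsTime_add (t v : ℝ) :
    rsTime H κ ξ' t v = rsTime H κ ξ t v + (ξ'.td - ξ.td - κ * (ξ'.tr - ξ.tr)) +
      (ξ'.tr - ξ.tr) / H * v := by
  simp only [rsTime]
  ring

theorem uIcc_rsTime_subset_image (hT : 0 < T) (hy : ContinuousOn y (Icc t₀ (t₀ + T))) :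
    uIcc (rsTime H κ ξ t₀ (y t₀ 1)) (rsTime H κ ξ (t₀ + T) (y (t₀ + T) 1)) ⊆
      (fun t => rsTime H κ ξ t (y t 1)) '' Icc t₀ (t₀ + T) := by
  have hle : t₀ ≤ t₀ + T := (lt_add_of_pos_right t₀ hT).le
  have hrow : ContinuousOn (fun t => y t 1) (Icc t₀ (t₀ + T)) := continuousOn_pi.mp hy 1
  have htime : ContinuousOn (fun t => rsTime H κ ξ t (y t 1)) (Icc t₀ (t₀ + T)) := by
    unfold rsTime
    fun_prop
  exact (isPreconnected_Icc.image _ htime).ordConnected.uIcc_subset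
    (mem_image_of_mem _ (left_mem_Icc.mpr hle)) (mem_image_of_mem _ (right_mem_Icc.mpr hle))

theorem rsTime_ne_of_row_eq {r : ℝ → ℝ} {t₁ : ℝ} (ht : t₀ ≠ t₁)
    (h₀ : y t₀ 1 = r (rsTime H κ ξ t₀ (y t₀ 1))) (h₁ : y t₁ 1 = r (rsTime H κ ξ t₁ (y t₁ 1))) :
    rsTime H κ ξ t₀ (y t₀ 1) ≠ rsTime H κ ξ t₁ (y t₁ 1) := by
  intro h
  have hrow : y t₀ 1 = y t₁ 1 := by rw [h₀, h, ← h₁]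
  simp only [rsTime, hrow, add_left_inj] at h
  exact ht h

/-- The initial time of the genericity condition is the time of the first observation, which depends
on the state only: the row recorded first is that of `ξ.nav`. -/
theorem readout_eq_of_isGenericInput (hcol : ∀ θ x, h θ x 0 = imgCol θ x)
    (hrow : ∀ θ x, h θ x 1 = imgRow θ x) (hH : H ≠ 0) (hT : 0 < T)
    (hu : IsGenericInput (dyn ξ.cal) (fun x => (imgCol ξ.cal x, imgRow ξ.cal x)) augDyn
      (fun w => imgCol w.2 w.1) (rsTime H κ ξ t₀ (imgRow ξ.cal ξ.nav)) ξ.nav u)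
    (hy : IsRecord h H κ t₀ T ξ u y) (hy' : IsRecord h H κ t₀ T ξ' u y) : ξ'.tr = ξ.tr := by
  obtain ⟨hyc, a, b, x, hx, hmem, hx₀, hobs⟩ := hy
  obtain ⟨-, a', b', x', hx', hmem', -, hobs'⟩ := hy'
  have hyrow : ∀ t ∈ Icc t₀ (t₀ + T), y t 1 = imgRow ξ.cal (x (rsTime H κ ξ t (y t 1))) :=
    fun t ht => (congrFun (hobs t ht) 1).trans (hrow _ _)
  have hle : t₀ ≤ t₀ + T := (lt_add_of_pos_right t₀ hT).le
  have hrow₀ := hyrow t₀ (left_mem_Icc.mpr hle)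
  have hrow₁ := hyrow (t₀ + T) (right_mem_Icc.mpr hle)
  have hsub := uIcc_rsTime_subset_image (H := H) (κ := κ) (ξ := ξ) hT hyc
  have hne := rsTime_ne_of_row_eq (r := fun s => imgRow ξ.cal (x s)) (by linarith) hrow₀ hrow₁
  have hx'_aug : IsIntegralCurveOn (fun s => (x' s, ξ'.cal)) (u.field augDyn) (Ioo a' b') :=
    (isIntegralCurveOn_iff_hasDerivAt isOpen_Ioo).mpr fun s hs =>
      (hx' s hs).prodMk (hasDerivAt_const s ξ'.cal)
  rw [hx₀] at hrow₀
  rw [← hrow₀, ← hx₀] at hu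
  have hdelay : (ξ'.tr - ξ.tr) / H = 0 := by
    refine hu.delay_eq_zero (c := ξ'.td - ξ.td - κ * (ξ'.tr - ξ.tr)) (continuous_img ξ.cal)
      ((isIntegralCurveOn_iff_hasDerivAt isOpen_Ioo).mpr hx)
      (hsub.trans (image_subset_iff.mpr hmem)) hne hx'_aug fun s hs => ?_
    obtain ⟨t, ht, rfl⟩ := hsub hs
    simp only [← hyrow t ht, ← rsTime_eq_rsTime_add]
    refine ⟨hmem' t ht, ?_⟩
    rw [← hcol, ← hcol, ← hobs t ht, ← hobs' t ht]
  exact sub_eq_zero.mp ((div_eq_zero_iff.mp hdelay).resolve_right hH)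

/-- The full state in which the time offset compensates, in row `r`, for a change of the readout
time of `ξ` by `ε`. -/
def FullState.compensated (ξ : FullState) (H κ r ε : ℝ) : FullState :=
  (ξ.nav, ξ.cal, ξ.td - (r / H - κ) * ε, ξ.tr + ε)

theorem FullState.rsTime_compensated (ξ : FullState) (r ε t : ℝ) :
    rsTime H κ (ξ.compensated H κ r ε) t r = rsTime H κ ξ t r := by
  simp only [rsTime, compensated]
  ring

theorem FullState.tendsto_compensated (ξ : FullState) (H κ r : ℝ) :
    Tendsto (ξ.compensated H κ r) (𝓝 0) (𝓝 ξ) := by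
  unfold compensated
  exact Continuous.tendsto' (by fun_prop) _ _ (by simp only [mul_zero, sub_zero, add_zero])

theorem IsRecord.compensated (hy : IsRecord h H κ t₀ T ξ u y)
    (hconst : ∀ t ∈ Icc t₀ (t₀ + T), y t 1 = y t₀ 1) (ε : ℝ) :
    IsRecord h H κ t₀ T (ξ.compensated H κ (y t₀ 1) ε) u y := by
  obtain ⟨hyc, a, b, x, hx, hmem, hx₀, hobs⟩ := hy
  have htime : ∀ t ∈ Icc t₀ (t₀ + T),
      rsTime H κ (ξ.compensated H κ (y t₀ 1) ε) t (y t 1) = rsTime H κ ξ t (y t 1) :=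
    fun t ht => by rw [hconst t ht, ξ.rsTime_compensated]
  refine ⟨hyc, a, b, x, hx, fun t ht => ?_, ?_, fun t ht => ?_⟩
  · exact (htime t ht).symm ▸ hmem t ht
  · exact (congrArg x (ξ.rsTime_compensated _ ε t₀)).trans hx₀
  · exact (htime t ht).symm ▸ hobs t ht

theorem readoutUnobservableIfConstant (h : Calib → NavState → Fin (n + 2) → ℝ) (H κ t₀ : ℝ)
    (ξ : FullState) : ReadoutUnobservableIfConstant h H κ t₀ ξ := by
  rintro u T - y hy hconst ⟨N, hN, hobs⟩
  obtain ⟨ε, hε, hne⟩ := (((ξ.tendsto_compensated H κ (y t₀ 1)).eventually_mem hN).filter_mono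
    nhdsWithin_le_nhds |>.and (self_mem_nhdsWithin (s := {(0 : ℝ)}ᶜ))).exists
  exact hne (add_eq_left.mp
    (hobs _ hε (hy.compensated (fun t ht => congrFun (hconst t ht) 1) ε)))

end Records

end RSVIO

open RSVIO in
theorem corollary1_general {n : ℕ} {h : Calib → NavState → Fin (n + 2) → ℝ}
    (hcol : ∀ θ x, h θ x 0 = imgCol θ x) (hrow : ∀ θ x, h θ x 1 = imgRow θ x) {H : ℝ} (hH : H ≠ 0)
    (κ t₀ : ℝ) (ξ : FullState) :
    (ξ.nav.ρ ≠ 0 → ξ.cal.qCB ≠ 0 → ξ.cal.Ma.det ≠ 0 → ξ.cal.intr 0 ≠ 0 → ξ.cal.intr 1 ≠ 0 →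
      ReadoutGenericallyDetermined h H κ t₀ ξ) ∧
    ReadoutUnobservableIfConstant h H κ t₀ ξ :=
  ⟨fun hρ hq hMa hfx hfy => (eventually_isGenericInput_dyn hq hMa hfx hfy hρ _).mono
    fun _ hu _ hT _ hy _ hy' => readout_eq_of_isGenericInput hcol hrow hH hT hu hy hy',
    readoutUnobservableIfConstant h H κ t₀ ξ⟩

end

theorem corollary1 (H κ t₀ : ℝ) (hH : 0 < H) (ξ : RSVIO.FullState) :
    (ξ.Regular →
      RSVIO.ReadoutGenericallyObservable RSVIO.imageObs H κ t₀ ξ ∧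
      RSVIO.ReadoutGenericallyObservable RSVIO.fullObs H κ t₀ ξ) ∧
    (RSVIO.ReadoutUnobservableIfConstant RSVIO.imageObs H κ t₀ ξ ∧
      RSVIO.ReadoutUnobservableIfConstant RSVIO.fullObs H κ t₀ ξ) := by
  have image := corollary1_general (n := 0) (h := RSVIO.imageObs) (fun _ _ => rfl) (fun _ _ => rfl)
    hH.ne' κ t₀ ξ
  have full := corollary1_general (n := 2) (h := RSVIO.fullObs) (fun _ _ => rfl) (fun _ _ => rfl)
    hH.ne' κ t₀ ξ
  refine ⟨fun hξ => ?_, image.2, full.2⟩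
  have hq : ξ.cal.qCB ≠ 0 := fun h => by simpa [h] using hξ.quat
  exact ⟨(image.1 hξ.depth.ne' hq hξ.acc hξ.focal_x.ne' hξ.focal_y.ne').observable,
    (full.1 hξ.depth.ne' hq hξ.acc hξ.focal_x.ne' hξ.focal_y.ne').observable⟩
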